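/- A triangle $T$ \emph{tiles} into a triangle $R$ (the \emph{tile}) with $N$ tiles if $T$ is the union of $N$ triangles congruent to $R$ (reflections allowed) with pairwise disjoint interiors. A triangle has \emph{incommensurable angles} if its angles are not all rational multiples of $\pi$. Let $T$ be a triangle in the Euclidean plane with incommensurable angles $(A,B,C)$, where $C=2A+B/2$, and suppose that $\sqrt3\,\tan(A/2)\in\mathbb{Q}$. Put $t=\tan(A/2)/\sqrt3$. Then there is a triangle $R$ with angles $(\alpha,\beta,\gamma)$, where $\alpha=A$ and $\beta=B/2$ (hence $\gamma=2\pi/3$), such that $T$ tiles into $R$ with some number of tiles. Moreover, whenever $T$ tiles into a triangle $R$ with angles $\alpha=A$, $\beta=B/2$, $\gamma=2\pi/3$ with $N$ tiles, there is a rational number $q$ with $$N=\frac{3t^2-6t-1}{(t-1)(3t+1)}\,q^2,$$ and $N$ is not a perfect square. -/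

import Mathlib

/-- The Euclidean plane. -/
abbrev Plane : Type := EuclideanSpace ℝ (Fin 2)

namespace TriangleTiling

/-- The interior angle of the triangle `T` at its vertex number `i` (indices are modulo `3`). -/
noncomputable def vertexAngle (T : Affine.Triangle ℝ Plane) (i : Fin 3) : ℝ :=
  EuclideanGeometry.angle (T.points (i + 1)) (T.points i) (T.points (i + 2))

/-- All angles of `T` are rational multiples of `π`. -/
def HasCommensurableAngles (T : Affine.Triangle ℝ Plane) : Prop :=
  ∀ i : Fin 3, ∃ q : ℚ, vertexAngle T i = (q : ℝ) * Real.pi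

/-- `tile` is a tiling of `T` into `N` congruent copies of `R`: each piece is congruent to `R`
(reflections are allowed; the vertices of a piece are listed in the order in which they correspond
to those of `R`), distinct pieces have disjoint interiors, and the pieces fill `T` exactly. -/
structure IsTiling (T R : Affine.Triangle ℝ Plane) {N : ℕ}
    (tile : Fin N → Affine.Triangle ℝ Plane) : Prop where
  congruent : ∀ i, Congruent (tile i).points R.points
  disjoint_interior : ∀ i j, i ≠ j → Disjoint (tile i).interior (tile j).interior
  iUnion_eq : (⋃ i, (tile i).closedInterior) = T.closedInterior

/-- `T` tiles into `N` triangles congruent to `R`. -/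
def TilesInto (T R : Affine.Triangle ℝ Plane) (N : ℕ) : Prop :=
  ∃ tile : Fin N → Affine.Triangle ℝ Plane, IsTiling T R tile

end TriangleTiling

/-! The angle sum gives `α + β = π/3`, so `T` has angles `α`, `2β`, `α + π/3`. Rationality of `t`
makes the sides of the tile proportional to integers `a`, `b`, `c` with `c² = a² + ab + b²`; up to
scale they are `4t`, `(1-3t)(1+t)`, `1+3t²`.

Existence. The bisector of the angle `2β` and one further cut split `T` into two triangles similar
to the tile and an equilateral triangle. The equilateral triangle is cut into three trapezoids
around its centre, and each trapezoid into horizontal strips. A strip consists of two scaled tiles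
in its obtuse corners, a parallelogram and a third scaled tile (`fillable_strip`). Taking `T` of a
suitable integral size relative to the tile makes all the multiplicities integers
(`fillable_bigTriangle`).

Counting. The side of `T` opposite `α` is a sum of full tile sides (`IsTiling.exists_side_eq`), so
the ratio of the scales of `T` and `R` is rational. Comparing areas (`IsTiling.card_mul`) then gives
`N = q²(a+b)(2a+b)` with `q` rational, which is the stated formula after a square factor is
absorbed.

Non-squareness. With `z = (1+3t)/(1-t)`, a square value of `N` would give a rational point on `y² =
x³ + 6x² - 3x` with `x = z > 1`. A descent on `u⁴ + 6u²v² - 3v⁴ = w²` (`quartic_descent`) shows that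
`x = 1` is the only positive abscissa of a rational point. -/

/-! ### Diophantine part: descent for the quartic and its elliptic curve. -/

theorem isCoprime_of_mul_eq_three_mul_pow {P Q v : ℤ} (hv : v ≠ 0) (h : P * Q = 3 * v ^ 4)
    (hp : ∀ p : ℤ, Prime p → p ∣ P → p ∣ Q → ¬ p ∣ v) : IsCoprime P Q := by
  have hPQ : P * Q ≠ 0 := by rw [h]; positivity
  refine isCoprime_of_prime_dvd (fun h0 => hPQ (by simp [h0.1])) fun p hpp h1 h2 => ?_
  have hpv := hp p hpp h1 h2
  -- As `p` does not divide `v`, its square would have to divide 3.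
  have h3 : p * p ∣ 3 * v ^ 4 := h ▸ mul_dvd_mul h1 h2
  have hc : IsCoprime p v := (hpp.coprime_iff_not_dvd).2 hpv
  have h4 : p * p ∣ 3 := (IsCoprime.mul_left hc.pow_right hc.pow_right).dvd_of_dvd_mul_right h3
  have h5 : p * p ≤ 3 := Int.le_of_dvd (by norm_num) h4
  have h6 : -1 ≤ p := by nlinarith
  have h7 : p ≤ 1 := by nlinarith
  have := hpp.ne_zero
  apply hpp.not_isUnit
  rw [Int.isUnit_iff]
  omega

/-- The prime 3 divides one of the coprime factors; dividing it out once leaves coprime factors of a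
fourth power. -/
theorem exists_pow_of_mul_eq_three_mul_pow {P Q : ℤ} {v : ℕ} (hP : 0 < P) (hQ : 0 < Q)
    (hc : IsCoprime P Q) (h : P * Q = 3 * v ^ 4) :
    ∃ m n : ℕ, v = m * n ∧ ((P = 3 * m ^ 4 ∧ Q = n ^ 4) ∨ (Q = 3 * m ^ 4 ∧ P = n ^ 4)) := by
  have key : ∀ P Q : ℤ, 0 < P → 0 < Q → IsCoprime P Q → P * Q = 3 * v ^ 4 → 3 ∣ P →
      ∃ m n : ℕ, v = m * n ∧ P = 3 * m ^ 4 ∧ Q = n ^ 4 := by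
    rintro P Q hP hQ hc h ⟨P', rfl⟩
    have hP' : 0 < P' := by linarith
    have hc' : IsCoprime P' Q := hc.of_mul_left_right
    lift P' to ℕ using hP'.le
    lift Q to ℕ using hQ.le
    have h' : P' * Q = v ^ 4 := by
      have : (P' * Q : ℤ) = v ^ 4 := by linarith
      exact_mod_cast this
    have hc'' := Nat.isCoprime_iff_coprime.1 hc'
    obtain ⟨m, hm⟩ := exists_eq_pow_of_mul_eq_pow (Nat.isUnit_iff.2 hc'') h'
    obtain ⟨n, hn⟩ := exists_eq_pow_of_mul_eq_pow (Nat.isUnit_iff.2 hc''.symm) ((mul_comm _ _).trans h')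
    refine ⟨m, n, ?_, by exact_mod_cast congrArg (3 * ·) hm, by exact_mod_cast hn⟩
    rw [hm, hn, ← mul_pow] at h'
    exact (Nat.pow_left_injective (n := 4) (by norm_num) h').symm
  have h3 : (3 : ℤ) ∣ P * Q := h ▸ Dvd.intro _ rfl
  rcases Int.prime_three.dvd_or_dvd h3 with h3 | h3
  · obtain ⟨m, n, h1, h2⟩ := key P Q hP hQ hc h h3
    exact ⟨m, n, h1, Or.inl h2⟩
  · obtain ⟨m, n, h1, h2⟩ := key Q P hQ hP hc.symm (by linarith) h3
    exact ⟨m, n, h1, Or.inr h2⟩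

/-- -1 is not a square modulo 3. -/
theorem three_dvd_of_sq_add_pow_four {s n : ℤ} (h : (3 : ℤ) ∣ s ^ 2 + n ^ 4) : (3 : ℤ) ∣ s := by
  have h1 : s % 3 = 0 ∨ s % 3 = 1 ∨ s % 3 = 2 := by omega
  have h2 : n % 3 = 0 ∨ n % 3 = 1 ∨ n % 3 = 2 := by omega
  have h3 := Int.emod_eq_zero_of_dvd h
  rcases h1 with h1 | h1 | h1 <;> rcases h2 with h2 | h2 | h2 <;>
    (simp [pow_succ, Int.add_emod, Int.mul_emod, h1, h2] at h3; try omega)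

set_option maxHeartbeats 1000000 in
/-- The only primitive positive solution of `u⁴ + 6u²v² - 3v⁴ = w²` with `v ≠ 0` is trivial. -/
theorem quartic_descent (v : ℕ) : ∀ u w : ℤ, 0 < v → IsCoprime u (v : ℤ) →
    u ^ 4 + 6 * u ^ 2 * v ^ 2 - 3 * v ^ 4 = w ^ 2 → u ^ 2 = 1 ∧ v = 1 := by
  induction v using Nat.strong_induction_on with
  | _ v ih =>
  intro u w hv huv h
  have hvz : (0 : ℤ) < v := by exact_mod_cast hv
  -- First factorization: `(u² + 3v²)² - w² = 12v⁴`. Both factors are even, and their halves `P`,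
  -- `Q` are coprime with product `3v⁴`.
  have hpar : ∃ P : ℤ, u ^ 2 + 3 * (v : ℤ) ^ 2 - w = 2 * P := by
    have h1 : Even (w ^ 2 - (u ^ 2 + 3 * (v : ℤ) ^ 2) ^ 2) := ⟨-6 * (v : ℤ) ^ 4, by rw [← h]; ring⟩
    have h2 : Even (u ^ 2 + 3 * (v : ℤ) ^ 2 - w) := by
      rw [Int.even_sub, Int.even_pow' two_ne_zero, Int.even_pow' two_ne_zero] at h1
      rw [Int.even_sub]
      exact h1.symm
    exact h2.two_dvd
  obtain ⟨P, hP⟩ := hpar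
  obtain ⟨Q, hQ⟩ : ∃ Q, Q = u ^ 2 + 3 * (v : ℤ) ^ 2 - P := ⟨_, rfl⟩
  have hw : w = Q - P := by linarith
  have hPQ : P * Q = 3 * (v : ℤ) ^ 4 := by
    have : 4 * (P * Q) = 12 * (v : ℤ) ^ 4 := by
      have h1 : u ^ 2 + 3 * (v : ℤ) ^ 2 = P + Q := by linarith
      have h2 : (P + Q) ^ 2 - 12 * (v : ℤ) ^ 4 = (Q - P) ^ 2 := by
        rw [← h1, ← hw, ← h]; ring
      linarith
    linarith
  have hv4 : (0 : ℤ) < (v : ℤ) ^ 4 := by positivity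
  have hsum : P + Q = u ^ 2 + 3 * (v : ℤ) ^ 2 := by linarith
  have hPpos : 0 < P := by
    by_contra hcon
    have : 0 < Q := by nlinarith [sq_nonneg u]
    nlinarith
  have hQpos : 0 < Q := by
    by_contra hcon
    nlinarith
  have hcop : IsCoprime P Q := by
    refine isCoprime_of_mul_eq_three_mul_pow hvz.ne' hPQ fun p hp h1 h2 h3 => ?_
    have h4 : p ∣ u ^ 2 := by
      have : u ^ 2 = P + Q - 3 * (v : ℤ) * v := by rw [hsum]; ring
      rw [this]
      exact dvd_sub (dvd_add h1 h2) (h3.mul_left _)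
    exact hp.not_isUnit (huv.isUnit_of_dvd' (hp.dvd_of_dvd_pow h4) h3)
  obtain ⟨r, s, hvrs, hrs⟩ := exists_pow_of_mul_eq_three_mul_pow hPpos hQpos hcop hPQ
  have hcop' : IsCoprime (3 * (r : ℤ) ^ 4) ((s : ℤ) ^ 4) := by
    rcases hrs with ⟨h1, h2⟩ | ⟨h1, h2⟩
    · rw [← h1, ← h2]; exact hcop
    · rw [← h1, ← h2]; exact hcop.symm
  have hu2 : u ^ 2 = (s : ℤ) ^ 4 - 3 * r ^ 2 * s ^ 2 + 3 * r ^ 4 := by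
    have hvz' : (v : ℤ) = r * s := by exact_mod_cast hvrs
    rw [hvz'] at hsum
    rcases hrs with ⟨h1, h2⟩ | ⟨h1, h2⟩ <;> rw [h1, h2] at hsum <;> linarith
  clear hrs hcop hQpos hPpos hsum hPQ hw hQ hP
  have hr : 0 < r := Nat.pos_of_ne_zero (by rintro rfl; omega)
  have hs : 0 < s := Nat.pos_of_ne_zero (by rintro rfl; omega)
  have hs3 : ¬ (3 : ℤ) ∣ s := fun h3 => Int.prime_three.not_isUnit
    ((IsCoprime.pow_right_iff (by norm_num)).1 hcop'.of_mul_left_left |>.isUnit_of_dvd' dvd_rfl h3)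
  have hrs : IsCoprime (r : ℤ) s :=
    (IsCoprime.pow_iff (by norm_num) (by norm_num)).1 hcop'.of_mul_left_right
  obtain ⟨x, hx, hx2⟩ : ∃ x : ℤ, 0 < x ∧ x ^ 2 = (s : ℤ) ^ 4 - 3 * r ^ 2 * s ^ 2 + 3 * r ^ 4 := by
    refine ⟨|u|, abs_pos.2 ?_, by rw [sq_abs, hu2]⟩
    rintro rfl
    have : (0 : ℤ) < (r : ℤ) ^ 4 := by positivity
    nlinarith [sq_nonneg (2 * (s : ℤ) ^ 2 - 3 * r ^ 2)]
  have done : v = 1 → u ^ 2 = 1 ∧ v = 1 := by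
    intro hv1
    have h1 : r = 1 := Nat.eq_one_of_mul_eq_one_right (hvrs.symm.trans hv1)
    have h2 : s = 1 := Nat.eq_one_of_mul_eq_one_left (hvrs.symm.trans hv1)
    refine ⟨?_, hv1⟩
    rw [hu2, h1, h2]; norm_num
  -- Second factorization: `x² - (s² - 3r²/2)² = 3r⁴/4`. For `r = 2k` the two factors are halved,
  -- with product `3k⁴`; for `r` odd they are doubled, with product `3r⁴`.
  rcases Nat.even_or_odd' r with ⟨k, hk | hk⟩
  · have hk0 : 0 < k := by omega
    have hkz : (r : ℤ) = 2 * k := by exact_mod_cast hk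
    have hkr : (k : ℤ) ∣ r := ⟨2, by rw [hkz]; ring⟩
    have hsodd : Odd (s : ℤ) := by
      rw [← Int.not_even_iff_odd]
      intro he
      exact Int.prime_two.not_isUnit (hrs.isUnit_of_dvd' ⟨k, hkz⟩ he.two_dvd)
    obtain ⟨P, hP⟩ : ∃ P : ℤ, x - s ^ 2 + 6 * k ^ 2 = 2 * P := by
      have h1 : Odd (x ^ 2) := by
        rw [hx2, hkz]
        have : (s : ℤ) ^ 4 - 3 * (2 * k) ^ 2 * s ^ 2 + 3 * (2 * k) ^ 4 =
          (s : ℤ) ^ 4 + 2 * (-6 * k ^ 2 * s ^ 2 + 24 * k ^ 4) := by ring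
        rw [this]
        exact hsodd.pow.add_even (even_two_mul _)
      have h2 : Odd x := by rwa [Int.odd_pow' two_ne_zero] at h1
      have h3 : Even (x - (s : ℤ) ^ 2 + 6 * k ^ 2) :=
        (h2.sub_odd hsodd.pow).add ⟨3 * (k : ℤ) ^ 2, by ring⟩
      exact h3.two_dvd
    obtain ⟨Q, hQ⟩ : ∃ Q, Q = x - P := ⟨_, rfl⟩
    have hd : Q - P = (s : ℤ) ^ 2 - 6 * k ^ 2 := by linarith
    have hPQ : P * Q = 3 * (k : ℤ) ^ 4 := by
      have h1 : (P + Q) ^ 2 - (Q - P) ^ 2 = 12 * (k : ℤ) ^ 4 := by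
        rw [hd, show P + Q = x by linarith, hx2, hkz]; ring
      linarith
    have hk4 : (0 : ℤ) < (k : ℤ) ^ 4 := by positivity
    have hPpos : 0 < P := by
      by_contra hcon
      have : 0 < Q := by linarith
      linarith [mul_nonpos_of_nonpos_of_nonneg (not_lt.1 hcon) this.le]
    have hQpos : 0 < Q := pos_of_mul_pos_right (by rw [hPQ]; positivity) hPpos.le
    have hcop : IsCoprime P Q := by
      refine isCoprime_of_mul_eq_three_mul_pow (by positivity) hPQ fun p hp h1 h2 h3 => ?_
      have h4 : p ∣ (s : ℤ) ^ 2 := by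
        have : (s : ℤ) ^ 2 = Q - P + 6 * (k : ℤ) * k := by rw [hd]; ring
        rw [this]
        exact dvd_add (dvd_sub h2 h1) (h3.mul_left _)
      exact hp.not_isUnit (hrs.isUnit_of_dvd' (h3.trans hkr) (hp.dvd_of_dvd_pow h4))
    obtain ⟨m, n, hkmn, ⟨h1, h2⟩ | ⟨h1, h2⟩⟩ :=
      exists_pow_of_mul_eq_three_mul_pow hPpos hQpos hcop hPQ
    · have hm0 : 0 < m := Nat.pos_of_ne_zero (by rintro rfl; omega)
      have hn0 : 0 < n := Nat.pos_of_ne_zero (by rintro rfl; omega)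
      have hmv : m < v := by
        have : m ≤ k := hkmn ▸ Nat.le_mul_of_pos_right _ hn0
        have : r ≤ v := hvrs ▸ Nat.le_mul_of_pos_right _ hs
        omega
      have hnm : IsCoprime (n : ℤ) m := by
        rw [h1, h2] at hcop
        exact ((IsCoprime.pow_iff (by norm_num) (by norm_num)).1 hcop.of_mul_left_right).symm
      have hkz' : (k : ℤ) = m * n := by exact_mod_cast hkmn
      rw [h1, h2, hkz'] at hd
      -- The pair `(n, m)` solves the original quartic with `w = s`. Induction leaves only `s² = 4`,
      -- but `s` is odd.
      obtain ⟨h5, h6⟩ := ih m hmv n s hm0 hnm (by linarith)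
      subst h6
      exfalso
      have h7 : (s : ℤ) ^ 2 = 4 := by
        have : (n : ℤ) ^ 4 = 1 := by rw [show (n : ℤ) ^ 4 = (n ^ 2) ^ 2 by ring, h5]; norm_num
        push_cast at hd
        nlinarith
      have h8 : Odd ((s : ℤ) ^ 2) := hsodd.pow
      rw [h7] at h8
      exact absurd h8 (by decide)
    · exfalso
      have hkz' : (k : ℤ) = m * n := by exact_mod_cast hkmn
      rw [h1, h2, hkz'] at hd
      refine hs3 (three_dvd_of_sq_add_pow_four (n := n) ⟨(m : ℤ) ^ 4 + 2 * (m * n) ^ 2, ?_⟩)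
      linarith
  · have hkz : (r : ℤ) = 2 * k + 1 := by exact_mod_cast hk
    obtain ⟨P, hP⟩ : ∃ P : ℤ, P = 2 * x - 2 * s ^ 2 + 3 * r ^ 2 := ⟨_, rfl⟩
    obtain ⟨Q, hQ⟩ : ∃ Q : ℤ, Q = 2 * x + 2 * s ^ 2 - 3 * r ^ 2 := ⟨_, rfl⟩
    have hd : Q - P = 4 * (s : ℤ) ^ 2 - 6 * r ^ 2 := by linarith
    have hPQ : P * Q = 3 * (r : ℤ) ^ 4 := by
      have h1 : P * Q = 4 * x ^ 2 - (2 * s ^ 2 - 3 * r ^ 2) ^ 2 := by rw [hP, hQ]; ring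
      rw [h1, hx2]; ring
    have hk4 : (0 : ℤ) < (r : ℤ) ^ 4 := by positivity
    have hPpos : 0 < P := by
      by_contra hcon
      have : 0 < Q := by linarith
      linarith [mul_nonpos_of_nonpos_of_nonneg (not_lt.1 hcon) this.le]
    have hQpos : 0 < Q := pos_of_mul_pos_right (by rw [hPQ]; positivity) hPpos.le
    have hcop : IsCoprime P Q := by
      refine isCoprime_of_mul_eq_three_mul_pow (by positivity) hPQ fun p hp h1 h2 h3 => ?_
      have h4 : p ∣ 2 * 2 * (s : ℤ) ^ 2 := by
        have : 2 * 2 * (s : ℤ) ^ 2 = Q - P + 6 * (r : ℤ) * r := by rw [hd]; ring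
        rw [this]
        exact dvd_add (dvd_sub h2 h1) (h3.mul_left _)
      rcases hp.dvd_or_dvd h4 with h4 | h4
      · have h5 : p ∣ 2 := by rcases hp.dvd_or_dvd h4 with h4 | h4 <;> exact h4
        have h6 : p ∣ 1 := by
          have : (1 : ℤ) = r - 2 * k := by rw [hkz]; ring
          rw [this]
          exact dvd_sub h3 (h5.mul_right _)
        exact hp.not_isUnit (isUnit_of_dvd_one h6)
      · exact hp.not_isUnit (hrs.isUnit_of_dvd' h3 (hp.dvd_of_dvd_pow h4))
    obtain ⟨m, n, hkmn, ⟨h1, h2⟩ | ⟨h1, h2⟩⟩ :=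
      exists_pow_of_mul_eq_three_mul_pow hPpos hQpos hcop hPQ
    · have hm0 : 0 < m := Nat.pos_of_ne_zero (by rintro rfl; omega)
      have hn0 : 0 < n := Nat.pos_of_ne_zero (by rintro rfl; omega)
      have hnm : IsCoprime (n : ℤ) m := by
        rw [h1, h2] at hcop
        exact ((IsCoprime.pow_iff (by norm_num) (by norm_num)).1 hcop.of_mul_left_right).symm
      have hkz' : (r : ℤ) = m * n := by exact_mod_cast hkmn
      rw [h1, h2, hkz'] at hd
      -- The original quartic again, with `w = 2s`. Here `m` may equal `v`, so the descent need not
      -- be strict.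
      have heq : (n : ℤ) ^ 4 + 6 * n ^ 2 * m ^ 2 - 3 * m ^ 4 = (2 * s) ^ 2 := by linarith
      apply done
      have hvmns : v = m * (n * s) := by rw [hvrs, hkmn, mul_assoc]
      rcases (Nat.le_mul_of_pos_right m (Nat.mul_pos hn0 hs) |>.trans hvmns.ge).lt_or_eq with hmv | hmv
      · obtain ⟨h5, h6⟩ := ih m hmv n (2 * s) hm0 hnm heq
        have hn1 : n = 1 := by
          have h5' : n ^ 2 = 1 := by exact_mod_cast h5
          exact by simpa using h5'
        subst h6 hn1
        have hs1 : s = 1 := by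
          have : (s : ℤ) ^ 2 = 1 := by push_cast at heq; linarith
          have h5' : s ^ 2 = 1 := by exact_mod_cast this
          exact by simpa using h5'
        simp [hvmns, hs1]
      -- If `m = v`, then `n = s = 1` and the quartic collapses to `3(m² - 1)² = 0`.
      · have hns : n * s = 1 := by
          rw [← hmv] at hvmns
          exact Nat.eq_of_mul_eq_mul_left hm0 (by linarith)
        have hn1 : n = 1 := Nat.eq_one_of_mul_eq_one_right hns
        have hs1 : s = 1 := Nat.eq_one_of_mul_eq_one_left hns
        subst hn1 hs1
        have : ((m : ℤ) ^ 2 - 1) ^ 2 = 0 := by push_cast at heq; nlinarith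
        have h3 : (m : ℤ) ^ 2 = 1 := by
          have := pow_eq_zero_iff (two_ne_zero) |>.1 this
          linarith
        have h5' : m ^ 2 = 1 := by exact_mod_cast h3
        rw [← hmv]
        exact by simpa using h5'
    · exfalso
      have hkz' : (r : ℤ) = m * n := by exact_mod_cast hkmn
      rw [h1, h2, hkz'] at hd
      refine hs3 (three_dvd_of_sq_add_pow_four (n := n)
        ⟨(m : ℤ) ^ 4 + 2 * (m * n) ^ 2 - s ^ 2, ?_⟩)
      linarith

/-- This is about points with `x = p/q` on `y² = x³ + 6x² - 3x`. Since `q` is coprime to its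
cofactor, it is a square. If 3 does not divide `p`, then `p` is a square as well and the quartic
appears. If `p = 3p'`, then `p'` is a square and the remaining square is `≡ -q²` modulo 3, which
forces 3 to divide `q`. -/
theorem eq_of_mul_quadratic_isSquare {p q w : ℤ} (hp : 0 < p) (hq : 0 < q) (hpq : IsCoprime p q)
    (h : p * q * (p ^ 2 + 6 * p * q - 3 * q ^ 2) = w ^ 2) : p = q := by
  have sq_pos : ∀ {x y z : ℤ}, 0 < x → IsCoprime x y → x * y = z ^ 2 → ∃ d : ℕ, 0 < d ∧ x = d ^ 2 := by
    intro x y z hx hc hxy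
    obtain ⟨d, hd | hd⟩ := Int.sq_of_isCoprime hc hxy
    · refine ⟨d.natAbs, Int.natAbs_pos.2 ?_, by rw [hd]; simp⟩
      rintro rfl
      simp [hd] at hx
    · nlinarith [sq_nonneg d]
  obtain ⟨v, hv, hqv⟩ := sq_pos (y := p * (p ^ 2 + 6 * p * q - 3 * q ^ 2)) (z := w) hq (by
    refine IsCoprime.mul_right hpq.symm ?_
    have : p ^ 2 + 6 * p * q - 3 * q ^ 2 = p ^ 2 + q * (6 * p - 3 * q) := by ring
    rw [this]
    exact (hpq.symm.pow_right).add_mul_left_right _) (by rw [← h]; ring)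
  have hvw : ∃ w' : ℤ, p * (p ^ 2 + 6 * p * q - 3 * q ^ 2) = w' ^ 2 := by
    have h1 : (v : ℤ) ^ 2 ∣ w ^ 2 :=
      ⟨p * (p ^ 2 + 6 * p * q - 3 * q ^ 2), by rw [← h, ← hqv]; ring⟩
    obtain ⟨w', rfl⟩ := (Int.pow_dvd_pow_iff two_ne_zero).1 h1
    refine ⟨w', mul_left_cancel₀ hq.ne' ?_⟩
    linear_combination h - w' ^ 2 * hqv
  obtain ⟨w', hw'⟩ := hvw
  by_cases h3 : (3 : ℤ) ∣ p
  · exfalso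
    obtain ⟨p', rfl⟩ := h3
    have hp' : 0 < p' := by linarith
    have hc' : IsCoprime p' q := hpq.of_mul_left_right
    have h3q : ¬ (3 : ℤ) ∣ q := fun h3q =>
      Int.prime_three.not_isUnit (hpq.of_mul_left_left.isUnit_of_dvd' dvd_rfl h3q)
    have h1 : (3 : ℤ) ^ 2 ∣ w' ^ 2 := ⟨p' * (3 * p' ^ 2 + 6 * p' * q - q ^ 2), by rw [← hw']; ring⟩
    obtain ⟨x, rfl⟩ := (Int.pow_dvd_pow_iff two_ne_zero).1 h1
    have h2 : p' * (3 * p' ^ 2 + 6 * p' * q - q ^ 2) = x ^ 2 := by linarith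
    obtain ⟨d, hd, hpd⟩ := sq_pos hp' (by
      have : 3 * p' ^ 2 + 6 * p' * q - q ^ 2 = -q ^ 2 + p' * (3 * p' + 6 * q) := by ring
      rw [this]
      exact (hc'.pow_right.neg_right).add_mul_left_right _) h2
    have h4 : (d : ℤ) ^ 2 ∣ x ^ 2 := ⟨3 * p' ^ 2 + 6 * p' * q - q ^ 2, by rw [← h2, ← hpd]⟩
    obtain ⟨y, rfl⟩ := (Int.pow_dvd_pow_iff two_ne_zero).1 h4
    have h5 : 3 * p' ^ 2 + 6 * p' * q - q ^ 2 = y ^ 2 := by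
      refine mul_left_cancel₀ hp'.ne' ?_
      linear_combination h2 - y ^ 2 * hpd
    apply h3q
    rw [hqv] at h5 ⊢
    have h6 : (3 : ℤ) ∣ y ^ 2 + (v : ℤ) ^ 4 :=
      ⟨p' ^ 2 + 2 * p' * v ^ 2, by linear_combination -h5⟩
    have h7 := three_dvd_of_sq_add_pow_four h6
    have h8 : (3 : ℤ) ∣ (v : ℤ) ^ 4 := by
      have := dvd_sub h6 (dvd_pow h7 two_ne_zero)
      rwa [add_sub_cancel_left] at this
    exact dvd_pow (Int.prime_three.dvd_of_dvd_pow h8) two_ne_zero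
  · have hc3 : IsCoprime p 3 := ((Int.prime_three.coprime_iff_not_dvd).2 h3).symm
    obtain ⟨u, hu, hpu⟩ := sq_pos hp (by
      have : p ^ 2 + 6 * p * q - 3 * q ^ 2 = -(3 * q ^ 2) + p * (p + 6 * q) := by ring
      rw [this]
      exact ((hc3.mul_right hpq.pow_right).neg_right).add_mul_left_right _) hw'
    have h4 : (u : ℤ) ^ 2 ∣ w' ^ 2 := ⟨p ^ 2 + 6 * p * q - 3 * q ^ 2, by rw [← hw', ← hpu]⟩
    obtain ⟨y, rfl⟩ := (Int.pow_dvd_pow_iff two_ne_zero).1 h4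
    have h5 : p ^ 2 + 6 * p * q - 3 * q ^ 2 = y ^ 2 := by
      refine mul_left_cancel₀ hp.ne' ?_
      linear_combination hw' - y ^ 2 * hpu
    have huv : IsCoprime (u : ℤ) v := by
      rw [hpu, hqv] at hpq
      exact (IsCoprime.pow_iff (by norm_num) (by norm_num)).1 hpq
    obtain ⟨h6, h7⟩ := quartic_descent v u y hv huv (by rw [← h5, hpu, hqv]; ring)
    rw [hpu, hqv, h6, h7]; norm_num

/-- The substitution `z = (1+3t)/(1-t)` gives `z² + 6z - 3 = 4(1 + 6t - 3t²)/(1-t)²`, turning a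
square value into a point on the elliptic curve. The excluded abscissa `z = 1` corresponds to `t =
0`. -/
theorem not_isSquare_quartic {t : ℚ} (h0 : 0 < t) (h1 : t < 1 / 3) :
    ¬ IsSquare ((3 * t ^ 2 - 6 * t - 1) / ((t - 1) * (3 * t + 1))) := by
  rintro ⟨y, hy⟩
  have hden : (t - 1) * (3 * t + 1) ≠ 0 := mul_ne_zero (by linarith) (by linarith)
  rw [div_eq_iff hden] at hy
  have h1t : 1 - t ≠ 0 := by linarith
  obtain ⟨z, hz⟩ : ∃ z, z = (1 + 3 * t) / (1 - t) := ⟨_, rfl⟩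
  have hz1 : 1 < z := by rw [hz, lt_div_iff₀ (by linarith)]; linarith
  obtain ⟨Y, hY⟩ : ∃ Y : ℚ, z * (z ^ 2 + 6 * z - 3) = Y ^ 2 := by
    refine ⟨2 * y * (1 + 3 * t) / (1 - t), ?_⟩
    rw [hz]
    field_simp
    linear_combination (-4) * hy
  have hint : ((z.num * z.den * (z.num ^ 2 + 6 * z.num * z.den - 3 * (z.den : ℤ) ^ 2) : ℤ) : ℚ) =
      (Y * z.den ^ 2) * (Y * z.den ^ 2) := by
    have hd : (z.den : ℚ) ≠ 0 := by exact_mod_cast z.den_nz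
    have hzn : (z.num : ℚ) = z * z.den := (Rat.mul_den_eq_num z).symm
    push_cast
    rw [hzn]
    linear_combination (z.den : ℚ) ^ 4 * hY
  obtain ⟨w, hw⟩ := Rat.isSquare_intCast_iff.1 ⟨_, hint⟩
  have h2 := eq_of_mul_quadratic_isSquare (p := z.num) (q := z.den) (w := w)
    (Rat.num_pos.2 (by linarith)) (by exact_mod_cast z.den_pos)
    (Int.isCoprime_iff_gcd_eq_one.2 (by simpa [Int.gcd] using z.reduced)) (by rw [hw]; ring)
  have h3 : z = 1 := by
    rw [← Rat.num_div_den z, h2]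
    exact div_self (by exact_mod_cast z.den_nz)
  linarith

/-! ### Dissections in triangular-lattice coordinates. -/

open Topology

/-- The quadratic form of the triangular lattice. -/
def qform (z : ℝ × ℝ) : ℝ := z.1 ^ 2 + z.1 * z.2 + z.2 ^ 2

def cross (u v : ℝ × ℝ) : ℝ := u.1 * v.2 - u.2 * v.1

/-- The triangle with vertices `p`, `p + r • u`, `p + r • v`. -/
def tri (p u v : ℝ × ℝ) (r : ℝ) : Set (ℝ × ℝ) :=
  {z | ∃ s t : ℝ, 0 ≤ s ∧ 0 ≤ t ∧ s + t ≤ r ∧ z = p + s • u + t • v}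

/-- The parallelogram with vertex `p` and sides `m • u`, `n • v`. -/
def par (p u v : ℝ × ℝ) (m n : ℝ) : Set (ℝ × ℝ) :=
  {z | ∃ s t : ℝ, 0 ≤ s ∧ s ≤ m ∧ 0 ≤ t ∧ t ≤ n ∧ z = p + s • u + t • v}

/-- Regions that can be dissected into triangles with sides `a`, `b`, `c`, in the metric
given by `qform`. -/
inductive Fillable (a b c : ℝ) : Set (ℝ × ℝ) → Prop
  | tile (p u v : ℝ × ℝ) (hu : qform u = b ^ 2) (hv : qform v = a ^ 2)
      (huv : qform (u - v) = c ^ 2) (h : cross u v ≠ 0) : Fillable a b c (tri p u v 1)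
  | union {S S' : Set (ℝ × ℝ)} (hS : Fillable a b c S) (hS' : Fillable a b c S')
      (h : Disjoint (interior S) (interior S')) : Fillable a b c (S ∪ S')

/-- A common interior point lies on the separating line, and a small push along the normal `(α, β)`
leaves `S`. No convexity is needed. -/
theorem disjoint_interior_of_separated {S S' : Set (ℝ × ℝ)} {α β k : ℝ} (hαβ : α ≠ 0 ∨ β ≠ 0)
    (h1 : ∀ z ∈ S, α * z.1 + β * z.2 ≤ k) (h2 : ∀ z ∈ S', k ≤ α * z.1 + β * z.2) :
    Disjoint (interior S) (interior S') := by
  rw [Set.disjoint_left]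
  intro z hz hz'
  have hk := h2 z (interior_subset hz')
  have hlim : Filter.Tendsto (fun δ : ℝ => z + δ • (α, β)) (𝓝[>] 0) (𝓝 z) := by
    have hc : Continuous fun δ : ℝ => z + δ • (α, β) := by fun_prop
    have := hc.tendsto 0
    simp only [zero_smul, add_zero] at this
    exact this.mono_left nhdsWithin_le_nhds
  obtain ⟨δ, hδ, hδ0⟩ := ((hlim.eventually (mem_interior_iff_mem_nhds.1 hz)).and
    self_mem_nhdsWithin).exists
  have h3 := h1 _ hδ
  simp only [Prod.fst_add, Prod.snd_add, Prod.smul_fst, Prod.smul_snd, smul_eq_mul] at h3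
  have hδ0 : 0 < δ := hδ0
  have h4 : 0 < δ * (α ^ 2 + β ^ 2) := by
    rcases hαβ with h | h <;> positivity
  linarith

theorem Fillable.glue {a b c : ℝ} {S S' U : Set (ℝ × ℝ)} (hS : Fillable a b c S)
    (hS' : Fillable a b c S') (α β k : ℝ) (hαβ : α ≠ 0 ∨ β ≠ 0)
    (h1 : ∀ z ∈ S, α * z.1 + β * z.2 ≤ k) (h2 : ∀ z ∈ S', k ≤ α * z.1 + β * z.2)
    (hU : U = S ∪ S') : Fillable a b c U :=
  hU ▸ hS.union hS' (disjoint_interior_of_separated hαβ h1 h2)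

/-- Gluing along a line given in the coordinates of a basis `u`, `v`. -/
theorem Fillable.glue_basis {a b c : ℝ} {S S' U : Set (ℝ × ℝ)} (hS : Fillable a b c S)
    (hS' : Fillable a b c S') {p u v : ℝ × ℝ} (hD : cross u v ≠ 0) (α β k : ℝ)
    (hαβ : α ≠ 0 ∨ β ≠ 0)
    (h1 : ∀ z ∈ S, ∃ s t : ℝ, z = p + s • u + t • v ∧ α * s + β * t ≤ k)
    (h2 : ∀ z ∈ S', ∃ s t : ℝ, z = p + s • u + t • v ∧ k ≤ α * s + β * t)
    (hU : U = S ∪ S') : Fillable a b c U := by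
  obtain ⟨D, hDef⟩ : ∃ D, D = cross u v := ⟨_, rfl⟩
  rw [← hDef] at hD
  have hD2 : 0 < D ^ 2 := by positivity
  -- Cramer's rule for the functional `αs + βt`. The extra factor `D` makes the overall scale `D² >
  -- 0`, so the orientation of the basis is irrelevant.
  obtain ⟨A, hA⟩ : ∃ A, A = D * (α * v.2 - β * u.2) := ⟨_, rfl⟩
  obtain ⟨B, hB⟩ : ∃ B, B = D * (β * u.1 - α * v.1) := ⟨_, rfl⟩
  have key : ∀ s t : ℝ, A * (p + s • u + t • v).1 + B * (p + s • u + t • v).2 =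
      A * p.1 + B * p.2 + D ^ 2 * (α * s + β * t) := by
    intro s t
    simp only [Prod.fst_add, Prod.snd_add, Prod.smul_fst, Prod.smul_snd, smul_eq_mul]
    have hDef' : D = u.1 * v.2 - u.2 * v.1 := hDef
    rw [hA, hB]
    linear_combination (-D * (α * s + β * t)) * hDef'
  refine hS.glue hS' A B (A * p.1 + B * p.2 + D ^ 2 * k) ?_ ?_ ?_ hU
  · by_contra! h
    have hu : D ^ 2 * α = 0 := by
      have := key 1 0
      have h0 := key 0 0
      simp only [h.1, h.2] at this h0
      linarith
    have hv : D ^ 2 * β = 0 := by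
      have := key 0 1
      have h0 := key 0 0
      simp only [h.1, h.2] at this h0
      linarith
    rcases hαβ with h | h
    · exact h ((mul_eq_zero.1 hu).resolve_left hD2.ne')
    · exact h ((mul_eq_zero.1 hv).resolve_left hD2.ne')
  · intro z hz
    obtain ⟨s, t, rfl, h⟩ := h1 z hz
    rw [key]
    have := mul_le_mul_of_nonneg_left h hD2.le
    linarith
  · intro z hz
    obtain ⟨s, t, rfl, h⟩ := h2 z hz
    rw [key]
    have := mul_le_mul_of_nonneg_left h hD2.le
    linarith

theorem tri_swap (p u v : ℝ × ℝ) (r : ℝ) : tri p u v r = tri p v u r := by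
  ext z
  constructor <;>
  · rintro ⟨s, t, hs, ht, hst, rfl⟩
    exact ⟨t, s, ht, hs, by linarith, by module⟩

theorem par_swap (p u v : ℝ × ℝ) (m n : ℝ) : par p u v m n = par p v u n m := by
  ext z
  constructor <;>
  · rintro ⟨s, t, hs, hs', ht, ht', rfl⟩
    exact ⟨t, s, ht, ht', hs, hs', by module⟩

theorem tri_rotate (p u v : ℝ × ℝ) : tri p u v 1 = tri (p + u) (v - u) (-u) 1 := by
  ext z
  constructor
  · rintro ⟨s, t, hs, ht, hst, rfl⟩
    exact ⟨t, 1 - s - t, ht, by linarith, by linarith, by module⟩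
  · rintro ⟨s, t, hs, ht, hst, rfl⟩
    exact ⟨1 - s - t, s, by linarith, hs, by linarith, by module⟩

theorem cross_ne_zero_of_neg {u v : ℝ × ℝ} (h : cross u v ≠ 0) : cross v u ≠ 0 := by
  intro h'
  apply h
  simp only [cross] at *
  linarith

/-! ### Parallelograms and scaled triangles made of copies of one triangle. -/

section lattice

variable {a b c : ℝ} {x y : ℝ × ℝ}

theorem fillable_par_one (hD : cross x y ≠ 0) (h : ∀ p, Fillable a b c (tri p x y 1))
    (h' : ∀ p, Fillable a b c (tri p (-x) (-y) 1)) (p : ℝ × ℝ) :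
    Fillable a b c (par p x y 1 1) := by
  refine (h p).glue_basis (h' (p + x + y)) (p := p) hD 1 1 1 (by simp) ?_ ?_ ?_
  · rintro z ⟨s, t, hs, ht, hst, rfl⟩
    exact ⟨s, t, rfl, by linarith⟩
  · rintro z ⟨s, t, hs, ht, hst, rfl⟩
    exact ⟨1 - s, 1 - t, by module, by linarith⟩
  · ext z
    constructor
    · rintro ⟨s, t, hs, hs', ht, ht', rfl⟩
      rcases le_total (s + t) 1 with h | h
      · exact Or.inl ⟨s, t, hs, ht, h, rfl⟩
      · exact Or.inr ⟨1 - s, 1 - t, by linarith, by linarith, by linarith, by module⟩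
    · rintro (⟨s, t, hs, ht, hst, rfl⟩ | ⟨s, t, hs, ht, hst, rfl⟩)
      · exact ⟨s, t, hs, by linarith, ht, by linarith, rfl⟩
      · exact ⟨1 - s, 1 - t, by linarith, by linarith, by linarith, by linarith, by module⟩

theorem fillable_par_row (hD : cross x y ≠ 0) {r : ℝ} (h : ∀ p, Fillable a b c (par p x y 1 r))
    (n : ℕ) (p : ℝ × ℝ) : Fillable a b c (par p x y (n + 1) r) := by
  induction n with
  | zero => simpa using h p
  | succ n ih =>
    push_cast
    have hn : (0 : ℝ) ≤ n := n.cast_nonneg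
    refine ih.glue_basis (h (p + ((n : ℝ) + 1) • x)) (p := p) hD 1 0 (n + 1) (by simp) ?_ ?_ ?_
    · rintro z ⟨s, t, hs, hs', ht, ht', rfl⟩
      exact ⟨s, t, rfl, by linarith⟩
    · rintro z ⟨s, t, hs, hs', ht, ht', rfl⟩
      exact ⟨s + (n + 1), t, by module, by linarith⟩
    · ext z
      constructor
      · rintro ⟨s, t, hs, hs', ht, ht', rfl⟩
        rcases le_total s (n + 1) with h | h
        · exact Or.inl ⟨s, t, hs, h, ht, ht', rfl⟩
        · exact Or.inr ⟨s - (n + 1), t, by linarith, by linarith, ht, ht', by module⟩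
      · rintro (⟨s, t, hs, hs', ht, ht', rfl⟩ | ⟨s, t, hs, hs', ht, ht', rfl⟩)
        · exact ⟨s, t, hs, by linarith, ht, ht', rfl⟩
        · exact ⟨s + (n + 1), t, by linarith, by linarith, ht, ht', by module⟩

theorem fillable_par (hD : cross x y ≠ 0) (h : ∀ p, Fillable a b c (tri p x y 1))
    (h' : ∀ p, Fillable a b c (tri p (-x) (-y) 1)) {m n : ℕ} (hm : 0 < m) (hn : 0 < n)
    (p : ℝ × ℝ) : Fillable a b c (par p x y m n) := by
  obtain ⟨m, rfl⟩ := Nat.exists_eq_succ_of_ne_zero hm.ne'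
  obtain ⟨n, rfl⟩ := Nat.exists_eq_succ_of_ne_zero hn.ne'
  push_cast
  refine fillable_par_row hD (fun p => ?_) m p
  rw [par_swap]
  refine fillable_par_row (cross_ne_zero_of_neg hD) (fun p => ?_) n p
  rw [par_swap]
  exact fillable_par_one hD h h' p

/-- The bottom row, a parallelogram ending in one unit triangle, is peeled off; above it lies a
triangle one size smaller. -/
theorem fillable_tri (hD : cross x y ≠ 0) (h : ∀ p, Fillable a b c (tri p x y 1))
    (h' : ∀ p, Fillable a b c (tri p (-x) (-y) 1)) {n : ℕ} (hn : 0 < n) (p : ℝ × ℝ) :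
    Fillable a b c (tri p x y n) := by
  obtain ⟨n, rfl⟩ := Nat.exists_eq_succ_of_ne_zero hn.ne'
  clear hn
  induction n generalizing p with
  | zero => simpa using h p
  | succ n ih =>
    have hn : (0 : ℝ) ≤ n := n.cast_nonneg
    have h1 : Fillable a b c (par p x y (n + 1) 1 ∪ tri (p + ((n : ℝ) + 1) • x) x y 1) := by
      have h2 := fillable_par hD h h' (m := n + 1) (n := 1) (by simp) (by simp) p
      push_cast at h2
      refine h2.glue_basis (h (p + ((n : ℝ) + 1) • x)) (p := p) hD 1 0 (n + 1) (by simp)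
        ?_ ?_ rfl
      · rintro z ⟨s, t, hs, hs', ht, ht', rfl⟩
        exact ⟨s, t, rfl, by linarith⟩
      · rintro z ⟨s, t, hs, ht, hst, rfl⟩
        exact ⟨s + (n + 1), t, by module, by linarith⟩
    refine h1.glue_basis (ih (p + y)) (p := p) hD 0 1 1 (by simp) ?_ ?_ ?_
    · rintro z (⟨s, t, hs, hs', ht, ht', rfl⟩ | ⟨s, t, hs, ht, hst, rfl⟩)
      · exact ⟨s, t, rfl, by linarith⟩
      · exact ⟨s + (n + 1), t, by module, by linarith⟩
    · rintro z ⟨s, t, hs, ht, hst, rfl⟩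
      exact ⟨s, t + 1, by module, by linarith⟩
    · push_cast
      ext z
      constructor
      · rintro ⟨s, t, hs, ht, hst, rfl⟩
        rcases le_total t 1 with h | h
        · left
          rcases le_total s (n + 1) with h2 | h2
          · exact Or.inl ⟨s, t, hs, h2, ht, h, rfl⟩
          · exact Or.inr ⟨s - (n + 1), t, by linarith, ht, by linarith, by module⟩
        · exact Or.inr ⟨s, t - 1, hs, by linarith, by linarith, by module⟩
      · rintro ((⟨s, t, hs, hs', ht, ht', rfl⟩ | ⟨s, t, hs, ht, hst, rfl⟩) | ⟨s, t, hs, ht, hst, rfl⟩)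
        · exact ⟨s, t, hs, ht, by linarith, rfl⟩
        · exact ⟨s + (n + 1), t, by linarith, ht, by linarith, by module⟩
        · exact ⟨s, t + 1, hs, by linarith, by linarith, by module⟩

end lattice

theorem mem_tri_iff {p u v : ℝ × ℝ} {r : ℝ} (hD : 0 < cross u v) (z : ℝ × ℝ) :
    z ∈ tri p u v r ↔ 0 ≤ cross (z - p) v ∧ 0 ≤ cross u (z - p) ∧
      cross (z - p) v + cross u (z - p) ≤ r * cross u v := by
  have e1 : ∀ s t : ℝ, cross (p + s • u + t • v - p) v = s * cross u v := by
    intro s t; simp [cross]; ring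
  have e2 : ∀ s t : ℝ, cross u (p + s • u + t • v - p) = t * cross u v := by
    intro s t; simp [cross]; ring
  constructor
  · rintro ⟨s, t, hs, ht, hst, rfl⟩
    rw [e1, e2]
    refine ⟨by positivity, by positivity, ?_⟩
    rw [← add_mul]
    exact mul_le_mul_of_nonneg_right hst hD.le
  · rintro ⟨h1, h2, h3⟩
    refine ⟨cross (z - p) v / cross u v, cross u (z - p) / cross u v, by positivity,
      by positivity, ?_, ?_⟩
    · rw [← add_div, div_le_iff₀ hD]; exact h3
    · have hD' := hD.ne'
      ext
      · simp only [Prod.fst_add, Prod.smul_fst, smul_eq_mul]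
        field_simp
        simp [cross]; ring
      · simp only [Prod.snd_add, Prod.smul_snd, smul_eq_mul]
        field_simp
        simp [cross]; ring

theorem mem_par_iff {p u v : ℝ × ℝ} {m n : ℝ} (hD : 0 < cross u v) (z : ℝ × ℝ) :
    z ∈ par p u v m n ↔ 0 ≤ cross (z - p) v ∧ cross (z - p) v ≤ m * cross u v ∧
      0 ≤ cross u (z - p) ∧ cross u (z - p) ≤ n * cross u v := by
  have e1 : ∀ s t : ℝ, cross (p + s • u + t • v - p) v = s * cross u v := by
    intro s t; simp [cross]; ring
  have e2 : ∀ s t : ℝ, cross u (p + s • u + t • v - p) = t * cross u v := by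
    intro s t; simp [cross]; ring
  constructor
  · rintro ⟨s, t, hs, hs', ht, ht', rfl⟩
    rw [e1, e2]
    exact ⟨by positivity, mul_le_mul_of_nonneg_right hs' hD.le, by positivity,
      mul_le_mul_of_nonneg_right ht' hD.le⟩
  · rintro ⟨h1, h2, h3, h4⟩
    refine ⟨cross (z - p) v / cross u v, cross u (z - p) / cross u v, by positivity,
      by rwa [div_le_iff₀ hD], by positivity, by rwa [div_le_iff₀ hD], ?_⟩
    have hD' := hD.ne'
    ext
    · simp only [Prod.fst_add, Prod.smul_fst, smul_eq_mul]
      field_simp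
      simp [cross]; ring
    · simp only [Prod.snd_add, Prod.smul_snd, smul_eq_mul]
      field_simp
      simp [cross]; ring

theorem Fillable.scaled_tile {a b c : ℝ} {u v : ℝ × ℝ} (hu : qform u = b ^ 2)
    (hv : qform v = a ^ 2) (huv : qform (u - v) = c ^ 2) (h : cross u v ≠ 0) {n : ℕ} (hn : 0 < n)
    (p : ℝ × ℝ) : Fillable a b c (tri p u v n) := by
  refine fillable_tri h (fun p => .tile p u v hu hv huv h) (fun p => .tile p _ _ ?_ ?_ ?_ ?_) hn p
  · rw [← hu]; simp [qform]
  · rw [← hv]; simp [qform]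
  · rw [← huv]; simp [qform]; ring
  · simpa [cross] using h

/-- `Fillable` is invariant under the rotation by `2π/3` about `(k/3, k/3)`. -/
theorem Fillable.rotate {a b c : ℝ} {S : Set (ℝ × ℝ)} (hS : Fillable a b c S) (k : ℝ) :
    Fillable a b c ((fun z : ℝ × ℝ => (k - z.1 - z.2, z.1)) '' S) := by
  let ρ : ℝ × ℝ ≃ₜ ℝ × ℝ :=
    { toFun := fun z => (k - z.1 - z.2, z.1)
      invFun := fun z => (z.2, k - z.1 - z.2)
      left_inv := fun z => by ext <;> (simp; try ring)
      right_inv := fun z => by ext <;> simp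
      continuous_toFun := by fun_prop
      continuous_invFun := by fun_prop }
  change Fillable a b c (ρ '' S)
  induction hS with
  | tile p u v hu hv huv h =>
    have : ρ '' tri p u v 1 = tri (ρ p) (-u.1 - u.2, u.1) (-v.1 - v.2, v.1) 1 := by
      ext z
      constructor
      · rintro ⟨_, ⟨s, t, hs, ht, hst, rfl⟩, rfl⟩
        refine ⟨s, t, hs, ht, hst, ?_⟩
        ext <;> simp [ρ]
        ring
      · rintro ⟨s, t, hs, ht, hst, rfl⟩
        refine ⟨_, ⟨s, t, hs, ht, hst, rfl⟩, ?_⟩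
        ext <;> simp [ρ]
        ring
    rw [this]
    refine .tile _ _ _ ?_ ?_ ?_ ?_
    · rw [← hu]; simp [qform]; ring
    · rw [← hv]; simp [qform]; ring
    · rw [← huv]; simp [qform]; ring
    · intro h'
      apply h
      simp [cross] at h' ⊢
      linarith
  | union _ _ h ih1 ih2 =>
    rw [Set.image_union]
    refine ih1.union ih2 ?_
    rw [← ρ.image_interior, ← ρ.image_interior]
    exact (Set.disjoint_image_iff ρ.injective).2 h

/-! ### Strips of trapezoids with base angles `π/3`. -/

theorem leftTile_eq {a b c : ℝ} (ha : 0 < a) (hb : 0 < b) (y₀ : ℝ) :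
    tri (0, y₀ + a * b * c) (b, 0) (0, -a) (b * c) =
      {z | z.2 - y₀ ≤ a * b * c ∧ 0 ≤ z.1 ∧ a * z.1 ≤ b * (z.2 - y₀)} := by
  rw [tri_swap]
  ext z
  have hD : 0 < cross ((0, -a) : ℝ × ℝ) (b, 0) := by simp [cross]; positivity
  rw [mem_tri_iff hD]
  simp only [cross, Prod.fst_sub, Prod.snd_sub, Set.mem_ofPred_eq]
  constructor
  · rintro ⟨h1, h2, h3⟩
    refine ⟨?_, ?_, ?_⟩
    · nlinarith
    · nlinarith
    · nlinarith
  · rintro ⟨h1, h2, h3⟩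
    refine ⟨?_, ?_, ?_⟩
    · nlinarith
    · nlinarith
    · nlinarith

theorem rightTile_eq {a b c : ℝ} (ha : 0 < a) (hb : 0 < b) (x y₀ : ℝ) :
    tri (x - a * b * c, y₀ + a * b * c) (b, -b) (-a, 0) (a * c) =
      {z | z.2 - y₀ ≤ a * b * c ∧ z.1 + (z.2 - y₀) ≤ x ∧
        b * x ≤ b * z.1 + (a + b) * (z.2 - y₀)} := by
  rw [tri_swap]
  ext z
  have hab : 0 < a * b := by positivity
  have hD : 0 < cross ((-a, 0) : ℝ × ℝ) (b, -b) := by simp [cross]; positivity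
  rw [mem_tri_iff hD]
  simp only [cross, Prod.fst_sub, Prod.snd_sub, Set.mem_ofPred_eq]
  constructor
  · rintro ⟨h1, h2, h3⟩
    refine ⟨?_, ?_, ?_⟩
    · nlinarith
    · nlinarith
    · nlinarith
  · rintro ⟨h1, h2, h3⟩
    refine ⟨?_, ?_, ?_⟩
    · nlinarith
    · nlinarith
    · nlinarith

theorem middlePar_eq {a b c : ℝ} (ha : 0 < a) (hb : 0 < b) (hc : 0 < c) (y₀ m : ℝ) :
    par (0, y₀) (c, 0) (b ^ 2 / c, a * b / c) m (c ^ 2) =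
      {z | 0 ≤ z.2 - y₀ ∧ z.2 - y₀ ≤ a * b * c ∧ b * (z.2 - y₀) ≤ a * z.1 ∧
        a * z.1 ≤ b * (z.2 - y₀) + a * c * m} := by
  ext z
  have hab : 0 < a * b := by positivity
  have hD' : cross ((c, 0) : ℝ × ℝ) (b ^ 2 / c, a * b / c) = a * b := by simp [cross]; field_simp
  rw [mem_par_iff (by rw [hD']; exact hab), hD']
  have e1 : cross (z - (0, y₀)) (b ^ 2 / c, a * b / c) = b / c * (a * z.1 - b * (z.2 - y₀)) := by
    simp [cross]; field_simp
  have e2 : cross (c, 0) (z - (0, y₀)) = c * (z.2 - y₀) := by simp [cross]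
  have hbc : 0 < b / c := by positivity
  have e3 : m * (a * b) = b / c * (a * c * m) := by field_simp
  have e4 : c ^ 2 * (a * b) = c * (a * b * c) := by ring
  rw [e1, e2, e3, e4, mul_le_mul_iff_right₀ hbc, mul_le_mul_iff_right₀ hc,
    mul_nonneg_iff_of_pos_left hbc, mul_nonneg_iff_of_pos_left hc]
  simp only [Set.mem_ofPred_eq]
  constructor
  · rintro ⟨h1, h2, h3, h4⟩
    exact ⟨h3, h4, by linarith, by linarith⟩
  · rintro ⟨h1, h2, h3, h4⟩
    exact ⟨by linarith, by linarith, h1, h2⟩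

theorem middleTri_eq {a b c : ℝ} (ha : 0 < a) (hb : 0 < b) (hc : 0 < c)
    (habc : c ^ 2 = a ^ 2 + a * b + b ^ 2) (y₀ m : ℝ) :
    tri (c * m, y₀) (c, 0) (b ^ 2 / c, a * b / c) (c ^ 2) =
      {z | 0 ≤ z.2 - y₀ ∧ b * (z.2 - y₀) + a * c * m ≤ a * z.1 ∧
        b * z.1 + (a + b) * (z.2 - y₀) ≤ b * (c * (m + c ^ 2))} := by
  ext z
  have hab : 0 < a * b := by positivity
  have hD' : cross ((c, 0) : ℝ × ℝ) (b ^ 2 / c, a * b / c) = a * b := by simp [cross]; field_simp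
  rw [mem_tri_iff (by rw [hD']; exact hab), hD']
  have e1 : cross (z - (c * m, y₀)) (b ^ 2 / c, a * b / c) =
      b / c * (a * z.1 - a * c * m - b * (z.2 - y₀)) := by
    simp [cross]; field_simp
  have e2 : cross (c, 0) (z - (c * m, y₀)) = c * (z.2 - y₀) := by simp [cross]
  have hbc : 0 < b / c := by positivity
  have hac : 0 < a / c := by positivity
  have e3 : b / c * (a * z.1 - a * c * m - b * (z.2 - y₀)) + c * (z.2 - y₀) =
      c ^ 2 * (a * b) + a / c * (b * z.1 + (a + b) * (z.2 - y₀) - b * (c * (m + c ^ 2))) := by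
    field_simp
    linear_combination (z.2 - y₀) * habc
  rw [e1, e2, e3, mul_nonneg_iff_of_pos_left hbc, mul_nonneg_iff_of_pos_left hc,
    add_le_iff_nonpos_right, mul_nonpos_iff_pos_imp_nonpos]
  simp only [Set.mem_ofPred_eq]
  constructor
  · rintro ⟨h1, h2, h3, h4⟩
    exact ⟨h2, by linarith, by linarith [h3 hac]⟩
  · rintro ⟨h1, h2, h3⟩
    exact ⟨by linarith, h1, fun _ => by linarith, fun _ => hac.le⟩

/-- A horizontal strip of an isosceles trapezoid with base angles `π/3`. -/
def strip (x y₀ l : ℝ) : Set (ℝ × ℝ) :=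
  {z | 0 ≤ z.2 - y₀ ∧ z.2 - y₀ ≤ l ∧ 0 ≤ z.1 ∧ z.1 + (z.2 - y₀) ≤ x}

/-- Tiles scaled by `bc` and `ac` sit in the two upper corners, whose angle is `2π/3`; both scalings
give height `abc`. They use up `β` and `α` of the base angles `π/3 = α + β`, leaving base angles `α`
and `β`. The rest is therefore a tile scaled by `c²`, with its longest side on the base, next to a
parallelogram of base `cm`. -/
theorem fillable_strip {a b c m : ℕ} (ha : 0 < a) (hb : 0 < b) (hc : 0 < c) (hm : 0 < m)
    (habc : c ^ 2 = a ^ 2 + a * b + b ^ 2) (y₀ : ℝ) :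
    Fillable a b c (strip (c * (m + c ^ 2)) y₀ (a * b * c)) := by
  have ha' : (0 : ℝ) < a := by exact_mod_cast ha
  have hb' : (0 : ℝ) < b := by exact_mod_cast hb
  have hc' : (0 : ℝ) < c := by exact_mod_cast hc
  have hm' : (0 : ℝ) < m := by exact_mod_cast hm
  have habc' : (c : ℝ) ^ 2 = a ^ 2 + a * b + b ^ 2 := by exact_mod_cast habc
  have hL : Fillable a b c (tri (0, y₀ + a * b * c) (b, 0) (0, -a) (b * c)) := by
    have := Fillable.scaled_tile (a := a) (b := b) (c := c) (u := (b, 0)) (v := (0, -a))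
      (by simp [qform]) (by simp [qform]) (by simp [qform, habc']; ring)
      (by simp [cross]; exact ⟨hb.ne', ha.ne'⟩) (Nat.mul_pos hb hc) (0, y₀ + a * b * c)
    simpa using this
  obtain ⟨x, hx⟩ : ∃ x : ℝ, x = c * (m + c ^ 2) := ⟨_, rfl⟩
  have hR : Fillable a b c (tri (x - a * b * c, y₀ + a * b * c) (b, -b) (-a, 0) (a * c)) := by
    have := Fillable.scaled_tile (a := a) (b := b) (c := c) (u := (b, -b)) (v := (-a, 0))
      (by simp [qform]; ring) (by simp [qform]) (by simp [qform, habc']; ring)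
      (by simp [cross]; exact ⟨hb.ne', ha.ne'⟩) (Nat.mul_pos ha hc)
      (x - a * b * c, y₀ + a * b * c)
    simpa using this
  obtain ⟨e, he⟩ : ∃ e : ℝ × ℝ, e = ((b : ℝ) ^ 2 / c, (a : ℝ) * b / c) := ⟨_, rfl⟩
  obtain ⟨f, hf⟩ : ∃ f : ℝ × ℝ, f = ((c : ℝ), 0) := ⟨_, rfl⟩
  have hD : cross f e ≠ 0 := by
    have : cross f e = a * b := by simp [hf, he, cross]; field_simp
    rw [this]; positivity
  have q1 : qform e = b ^ 2 := by
    simp only [qform, he]; field_simp; rw [habc']; ring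
  have q2 : qform (f - e) = a ^ 2 := by
    simp only [qform, hf, he, Prod.fst_sub, Prod.snd_sub]; field_simp
    linear_combination ((c : ℝ) ^ 2 - b ^ 2) * habc'
  have q3 : qform f = c ^ 2 := by simp [qform, hf]
  have hq : ∀ z : ℝ × ℝ, qform (-z) = qform z := by intro z; simp [qform]
  -- The constructor wants the vertex between the sides `a` and `b` first, whereas `f` and `e` have
  -- lengths `c` and `b`; the vertices are relabelled.
  have hT : ∀ p, Fillable a b c (tri p f e 1) := by
    intro p
    rw [tri_swap, tri_rotate, tri_swap]
    refine .tile _ _ _ (by rw [hq, q1]) q2 ?_ ?_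
    · rw [show -e - (f - e) = -f by module, hq, q3]
    · rwa [show cross (-e) (f - e) = cross f e by simp [cross]; ring]
  have hT' : ∀ p, Fillable a b c (tri p (-f) (-e) 1) := by
    intro p
    rw [tri_swap, tri_rotate, tri_swap]
    refine .tile _ _ _ (by rw [neg_neg, q1]) ?_ ?_ ?_
    · rw [show -f - -e = -(f - e) by module, hq, q2]
    · rw [show - -e - (-f - -e) = f by module, q3]
    · rwa [show cross (- -e) (-f - -e) = cross f e by simp [cross]; ring]
  have hP : Fillable a b c (par (0, y₀) f e m (c ^ 2)) := by
    have := fillable_par hD hT hT' hm (pow_pos hc 2) (0, y₀)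
    simpa using this
  have hM : Fillable a b c (tri (c * m, y₀) f e (c ^ 2)) := by
    have := fillable_tri hD hT hT' (pow_pos hc 2) (c * m, y₀)
    simpa using this
  rw [leftTile_eq ha' hb'] at hL
  rw [rightTile_eq ha' hb'] at hR
  rw [hf, he, middlePar_eq ha' hb' hc'] at hP
  rw [hf, he, middleTri_eq ha' hb' hc' habc', ← hx] at hM
  have hx' : x = c * m + c * (a ^ 2 + a * b + b ^ 2) := by rw [hx, ← habc']; ring
  have hcm : (0 : ℝ) < c * m := by positivity
  have hca : (0 : ℝ) < c * a ^ 2 := by positivity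
  have hcb : (0 : ℝ) < c * b ^ 2 := by positivity
  -- The slanted side of the right tile meets the right side of the parallelogram only at height
  -- `abc`, so below that height the tile stays to the right.
  have hRsep : ∀ X Y : ℝ, Y ≤ a * b * c → b * x ≤ b * X + (a + b) * Y →
      b * Y + a * c * m ≤ a * X := by
    intro X Y h1 h2
    refine le_of_mul_le_mul_left ?_ hb'
    have h3 := mul_le_mul_of_nonneg_left h2 ha'.le
    have h4 := mul_le_mul_of_nonneg_left h1 (sq_nonneg (c : ℝ))
    rw [hx] at h3
    rw [habc'] at h3 h4
    linarith
  refine hL.glue (hP.glue (hM.glue hR b (a + b) (b * x + (a + b) * y₀) (Or.inl hb'.ne') ?_ ?_ rfl)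
    a (-b) (a * c * m - b * y₀) (Or.inl ha'.ne') ?_ ?_ rfl) a (-b) (-b * y₀) (Or.inl ha'.ne') ?_ ?_ ?_
  · rintro z ⟨h1, h2, h3⟩
    linarith
  · rintro z ⟨h1, h2, h3⟩
    linarith
  · rintro z ⟨h1, h2, h3, h4⟩
    linarith
  · rintro z (⟨h1, h2, h3⟩ | ⟨h1, h2, h3⟩)
    · linarith
    · linarith [hRsep _ _ h1 h3]
  · rintro z ⟨h1, h2, h3⟩
    linarith
  · rintro z (⟨h1, h2, h3, h4⟩ | ⟨h1, h2, h3⟩ | ⟨h1, h2, h3⟩)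
    · linarith
    · have : (0 : ℝ) < a * c * m := by positivity
      linarith
    · have : (0 : ℝ) < a * c * m := by positivity
      linarith [hRsep _ _ h1 h3]
  · ext z
    obtain ⟨X, hX⟩ : ∃ X, X = z.1 := ⟨_, rfl⟩
    obtain ⟨Y, hY⟩ : ∃ Y, Y = z.2 - y₀ := ⟨_, rfl⟩
    simp only [strip, Set.mem_union, Set.mem_ofPred_eq, ← hX, ← hY, ← hx]
    constructor
    · rintro ⟨h1, h2, h3, h4⟩
      rcases le_total (a * X) (b * Y) with h5 | h5
      · exact Or.inl ⟨h2, h3, h5⟩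
      right
      rcases le_total (a * X) (b * Y + a * c * m) with h6 | h6
      · exact Or.inl ⟨h1, h2, h5, h6⟩
      right
      rcases le_total (b * X + (a + b) * Y) (b * x) with h7 | h7
      · exact Or.inl ⟨h1, h6, h7⟩
      · exact Or.inr ⟨h2, h4, h7⟩
    · rintro (⟨h1, h2, h3⟩ | ⟨h1, h2, h3, h4⟩ | ⟨h1, h2, h3⟩ | ⟨h1, h2, h3⟩)
      · have hY0 : 0 ≤ Y := by
          have : 0 ≤ b * Y := le_trans (by positivity) h3
          exact (mul_nonneg_iff_of_pos_left hb').1 this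
        have hX1 : X ≤ c * b ^ 2 := by
          refine le_of_mul_le_mul_left (h3.trans ?_) ha'
          linarith [mul_le_mul_of_nonneg_left h1 hb'.le]
        exact ⟨hY0, h1, h2, by linarith⟩
      · have hX0 : 0 ≤ X := by
          have : 0 ≤ a * X := le_trans (by positivity) h3
          exact (mul_nonneg_iff_of_pos_left ha').1 this
        have hX1 : X ≤ c * b ^ 2 + c * m := by
          refine le_of_mul_le_mul_left (h4.trans ?_) ha'
          linarith [mul_le_mul_of_nonneg_left h2 hb'.le]
        exact ⟨h1, h2, hX0, by linarith⟩
      · have hX0 : 0 ≤ X := by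
          have : 0 ≤ a * X := le_trans (by positivity) h2
          exact (mul_nonneg_iff_of_pos_left ha').1 this
        have hY1 : Y ≤ a * b * c := by
          refine le_of_mul_le_mul_left ?_ (pow_pos hc' 2)
          have h4 := mul_le_mul_of_nonneg_left h2 hb'.le
          have h5 := mul_le_mul_of_nonneg_left h3 ha'.le
          rw [hx] at h5
          have h6 : (c : ℝ) ^ 2 * Y = (a ^ 2 + a * b + b ^ 2) * Y := by rw [habc']
          linarith
        refine ⟨h1, hY1, hX0, le_of_mul_le_mul_left ?_ hb'⟩
        linarith [mul_nonneg ha'.le h1]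
      · have hY0 : 0 ≤ Y := by
          refine (mul_nonneg_iff_of_pos_left ha').1 ?_
          linarith [mul_le_mul_of_nonneg_left h2 hb'.le]
        have hX0 : 0 ≤ X := by
          refine (mul_nonneg_iff_of_pos_left hb').1 ?_
          have h4 := mul_le_mul_of_nonneg_left h1 (add_pos ha' hb').le
          have h5 : (0 : ℝ) ≤ b * (c * m + c * b ^ 2) := by positivity
          rw [hx'] at h3
          linarith
        exact ⟨hY0, h1, hX0, h2⟩

/-- Rows of height `abc` are stacked, each with a base shorter by `abc` than the one below. The
bound on `k` says that even the top row has base more than `c²` units of `abc`, leaving room for a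
parallelogram of positive width. -/
theorem fillable_trapezoid {a b c : ℕ} (ha : 0 < a) (hb : 0 < b) (hc : 0 < c)
    (habc : c ^ 2 = a ^ 2 + a * b + b ^ 2) {k n : ℕ} (h : n + c ^ 2 < k) (y₀ : ℝ) :
    Fillable a b c (strip (a * b * c * k) y₀ ((n + 1) * (a * b * c))) := by
  have ha' : (0 : ℝ) < a := by exact_mod_cast ha
  have hb' : (0 : ℝ) < b := by exact_mod_cast hb
  have hc' : (0 : ℝ) < c := by exact_mod_cast hc
  have hl : (0 : ℝ) < a * b * c := by positivity
  have row : ∀ k : ℕ, c ^ 2 < k → ∀ y₀,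
      Fillable a b c (strip (a * b * c * k) y₀ (a * b * c)) := by
    intro k hk y₀
    have h1 : c ^ 2 < a * b * k := hk.trans_le (Nat.le_mul_of_pos_left _ (Nat.mul_pos ha hb))
    have h2 := fillable_strip (m := a * b * k - c ^ 2) ha hb hc (Nat.sub_pos_of_lt h1) habc y₀
    rw [Nat.cast_sub h1.le] at h2
    convert h2 using 2
    push_cast
    ring
  induction n generalizing k y₀ with
  | zero => simpa using row k (by omega) y₀
  | succ n ih =>
    obtain ⟨k, rfl⟩ : ∃ k', k = k' + 1 := ⟨k - 1, by omega⟩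
    have hn : (0 : ℝ) ≤ n := n.cast_nonneg
    refine (row (k + 1) (by omega) y₀).glue (ih (k := k) (by omega) (y₀ + a * b * c)) 0 1
      (y₀ + a * b * c) (by simp) ?_ ?_ ?_
    · rintro z ⟨h1, h2, h3, h4⟩
      linarith
    · rintro z ⟨h1, h2, h3, h4⟩
      linarith
    · have hnl := mul_nonneg hn hl.le
      ext z
      simp only [strip, Set.mem_union, Set.mem_ofPred_eq]
      push_cast
      constructor
      · rintro ⟨h1, h2, h3, h4⟩
        rcases le_total (z.2 - y₀) (a * b * c) with h5 | h5
        · exact Or.inl ⟨h1, h5, h3, h4⟩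
        · exact Or.inr ⟨by linarith, by linarith, h3, by linarith⟩
      · rintro (⟨h1, h2, h3, h4⟩ | ⟨h1, h2, h3, h4⟩)
        · exact ⟨h1, by linarith, h3, h4⟩
        · exact ⟨by linarith, by linarith, h3, by linarith⟩

/-! ### The equilateral triangle and the full triangle. -/

/-- The interior of a union can exceed the union of interiors. Removing the closed set `S` from the
interior of `U ∩ (S ∪ S')` leaves an open subset of `U ∩ S'`, hence nothing; so that interior lies
in `U ∩ S`. -/
theorem disjoint_interior_union {S S' U : Set (ℝ × ℝ)} (hc : IsClosed S)
    (h : Disjoint (interior U) (interior S)) (h' : Disjoint (interior U) (interior S')) :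
    Disjoint (interior U) (interior (S ∪ S')) := by
  rw [Set.disjoint_iff_inter_eq_empty, ← interior_inter] at *
  have h1 : interior (U ∩ (S ∪ S')) \ S ⊆ interior (U ∩ S') := by
    refine interior_maximal ?_ (isOpen_interior.sdiff hc)
    rintro z ⟨hz, hzS⟩
    exact ⟨(interior_subset hz).1, (interior_subset hz).2.resolve_left hzS⟩
  rw [h', Set.subset_empty_iff, Set.sdiff_eq_empty] at h1
  rw [← Set.subset_empty_iff, ← h]
  exact interior_maximal (fun z hz => ⟨(interior_subset hz).1, h1 hz⟩) isOpen_interior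

/-- An equilateral triangle, cut into three trapezoids around its centre. -/
theorem fillable_equilateral {a b c : ℕ} (ha : 0 < a) (hb : 0 < b) (hc : 0 < c)
    (habc : c ^ 2 = a ^ 2 + a * b + b ^ 2) :
    Fillable a b c {z | 0 ≤ z.1 ∧ 0 ≤ z.2 ∧ z.1 + z.2 ≤ 3 * (a * b * c ^ 3)} := by
  obtain ⟨h, hh⟩ : ∃ h : ℝ, h = a * b * c ^ 3 := ⟨_, rfl⟩
  have hh0 : 0 ≤ h := by rw [hh]; positivity
  have hZ : Fillable a b c (strip (2 * h) 0 h) := by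
    have hc2 : 0 < c ^ 2 := pow_pos hc 2
    -- There are `c²` rows on a base of `2c²` units; the top row still has `c² + 1` units, the least
    -- admissible number.
    have := fillable_trapezoid ha hb hc habc (k := 2 * c ^ 2) (n := c ^ 2 - 1) (by omega) 0
    rw [Nat.cast_sub hc2] at this
    convert this using 2 <;> push_cast <;> rw [hh] <;> ring
  have h1 := hZ.rotate (3 * h)
  have h2 := h1.rotate (3 * h)
  have e1 : (fun z : ℝ × ℝ => (3 * h - z.1 - z.2, z.1)) '' strip (2 * h) 0 h =
      {z | 0 ≤ 3 * h - z.1 - z.2 ∧ 3 * h - z.1 - z.2 ≤ h ∧ 0 ≤ z.2 ∧ h ≤ z.1} := by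
    ext z
    constructor
    · rintro ⟨w, ⟨h1, h2, h3, h4⟩, rfl⟩
      exact ⟨by linarith, by linarith, h3, by linarith⟩
    · rintro ⟨h1, h2, h3, h4⟩
      refine ⟨(z.2, 3 * h - z.1 - z.2), ⟨by linarith, by linarith, h3, by linarith⟩, ?_⟩
      ext <;> simp
  rw [e1] at h1 h2
  have e2 : (fun z : ℝ × ℝ => (3 * h - z.1 - z.2, z.1)) ''
      {z | 0 ≤ 3 * h - z.1 - z.2 ∧ 3 * h - z.1 - z.2 ≤ h ∧ 0 ≤ z.2 ∧ h ≤ z.1} =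
      {z | 0 ≤ z.1 ∧ z.1 ≤ h ∧ 0 ≤ 3 * h - z.1 - z.2 ∧ h ≤ z.2} := by
    ext z
    constructor
    · rintro ⟨w, ⟨h1, h2, h3, h4⟩, rfl⟩
      exact ⟨h1, h2, by linarith, h4⟩
    · rintro ⟨h1, h2, h3, h4⟩
      refine ⟨(z.2, 3 * h - z.1 - z.2), ⟨by linarith, by linarith, h3, h4⟩, ?_⟩
      ext <;> simp
  rw [e2] at h2
  rw [← hh]
  obtain ⟨S₀, hS₀⟩ : ∃ S, S = strip (2 * h) 0 h := ⟨_, rfl⟩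
  obtain ⟨S₁, hS₁⟩ : ∃ S : Set (ℝ × ℝ), S =
    {z | 0 ≤ 3 * h - z.1 - z.2 ∧ 3 * h - z.1 - z.2 ≤ h ∧ 0 ≤ z.2 ∧ h ≤ z.1} := ⟨_, rfl⟩
  obtain ⟨S₂, hS₂⟩ : ∃ S : Set (ℝ × ℝ), S =
    {z | 0 ≤ z.1 ∧ z.1 ≤ h ∧ 0 ≤ 3 * h - z.1 - z.2 ∧ h ≤ z.2} := ⟨_, rfl⟩
  have hclosed : IsClosed S₂ := by
    have i1 : IsClosed {z : ℝ × ℝ | 0 ≤ z.1} := isClosed_le (by fun_prop) (by fun_prop)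
    have i2 : IsClosed {z : ℝ × ℝ | z.1 ≤ h} := isClosed_le (by fun_prop) (by fun_prop)
    have i3 : IsClosed {z : ℝ × ℝ | 0 ≤ 3 * h - z.1 - z.2} :=
      isClosed_le (by fun_prop) (by fun_prop)
    have i4 : IsClosed {z : ℝ × ℝ | h ≤ z.2} := isClosed_le (by fun_prop) (by fun_prop)
    rw [hS₂]
    exact i1.inter (i2.inter (i3.inter i4))
  have h21 : Fillable a b c (S₂ ∪ S₁) := by
    rw [← hS₁] at h1
    rw [← hS₂] at h2
    refine h2.glue h1 1 0 h (by simp) ?_ ?_ rfl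
    · rw [hS₂]
      rintro z ⟨h1, h2, h3, h4⟩
      linarith
    · rw [hS₁]
      rintro z ⟨h1, h2, h3, h4⟩
      linarith
  have hU : {z : ℝ × ℝ | 0 ≤ z.1 ∧ 0 ≤ z.2 ∧ z.1 + z.2 ≤ 3 * h} = S₀ ∪ (S₂ ∪ S₁) := by
    rw [hS₀, hS₁, hS₂]
    ext z
    simp only [strip, Set.mem_union, Set.mem_ofPred_eq]
    constructor
    · rintro ⟨h1, h2, h3⟩
      rcases le_total z.2 h with h4 | h4
      · rcases le_total (z.1 + z.2) (2 * h) with h5 | h5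
        · exact Or.inl ⟨by linarith, by linarith, h1, by linarith⟩
        · exact Or.inr (Or.inr ⟨by linarith, by linarith, h2, by linarith⟩)
      · rcases le_total z.1 h with h5 | h5
        · exact Or.inr (Or.inl ⟨h1, h5, by linarith, h4⟩)
        · exact Or.inr (Or.inr ⟨by linarith, by linarith, h2, h5⟩)
    · rintro (⟨h1, h2, h3, h4⟩ | ⟨h1, h2, h3, h4⟩ | ⟨h1, h2, h3, h4⟩)
      · exact ⟨h3, by linarith, by linarith⟩
      · exact ⟨h1, by linarith, by linarith⟩
      · exact ⟨by linarith, h3, by linarith⟩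
  rw [hU]
  rw [← hS₀] at hZ
  -- No single line separates the bottom trapezoid from the union of the other two, so it is
  -- separated from each in turn.
  refine hZ.union h21 (disjoint_interior_union hclosed ?_ ?_)
  · refine disjoint_interior_of_separated (α := 0) (β := 1) (k := h) (by simp) ?_ ?_
    · rw [hS₀]
      rintro z ⟨h1, h2, h3, h4⟩
      linarith
    · rw [hS₂]
      rintro z ⟨h1, h2, h3, h4⟩
      linarith
  · refine disjoint_interior_of_separated (α := 1) (β := 1) (k := 2 * h) (by simp) ?_ ?_
    · rw [hS₀]
      rintro z ⟨h1, h2, h3, h4⟩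
      linarith
    · rw [hS₁]
      rintro z ⟨h1, h2, h3, h4⟩
      linarith

/-- The triangle with angles `α`, `2β`, `2α + β` is dissected into an equilateral triangle and two
triangles similar to the tile. -/
theorem fillable_bigTriangle {a b c : ℕ} (ha : 0 < a) (hb : 0 < b) (hc : 0 < c)
    (habc : c ^ 2 = a ^ 2 + a * b + b ^ 2) {L : ℝ} (hL : L = 3 * c ^ 3) :
    Fillable a b c (tri (-(L * (a + b) * b), 0) (L * b * (2 * a + b), 0)
      (L * (a + b) * b, L * (a + b) * a) 1) := by
  have ha' : (0 : ℝ) < a := by exact_mod_cast ha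
  have hb' : (0 : ℝ) < b := by exact_mod_cast hb
  have hc' : (0 : ℝ) < c := by exact_mod_cast hc
  have hL' : 0 < L := by rw [hL]; positivity
  have habc' : (c : ℝ) ^ 2 = a ^ 2 + a * b + b ^ 2 := by exact_mod_cast habc
  -- The axis `z.1 = 0` bisects the angle `2β` at `(0, L(a+b)a)`. Left of it is a scaled tile; right
  -- of it are the equilateral triangle on the base and a second scaled tile. The value of `L` makes
  -- the equilateral side `Lab` equal to `3abc³`.
  have h1 : Fillable a b c (tri (0, 0) (-b, 0) (0, a) (L * (a + b))) := by
    have := Fillable.scaled_tile (a := a) (b := b) (c := c) (u := (-b, 0)) (v := (0, a))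
      (by simp [qform]) (by simp [qform]) (by simp [qform, habc']; ring)
      (by simp [cross]; exact ⟨hb.ne', ha.ne'⟩) (n := 3 * c ^ 3 * (a + b)) (by positivity) (0, 0)
    push_cast at this
    rwa [hL]
  have h2 : Fillable a b c (tri (0, L * a * b) (b, -b) (0, a) (L * a)) := by
    have := Fillable.scaled_tile (a := a) (b := b) (c := c) (u := (b, -b)) (v := (0, a))
      (by simp [qform]; ring) (by simp [qform]) (by simp [qform, habc']; ring)
      (by simp [cross]; exact ⟨hb.ne', ha.ne'⟩) (n := 3 * c ^ 3 * a) (by positivity)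
      (0, L * a * b)
    push_cast at this
    rwa [hL] at this ⊢
  have h3 := fillable_equilateral ha hb hc habc
  rw [show 3 * (a * b * c ^ 3 : ℝ) = L * a * b by rw [hL]; ring] at h3
  have e1 : tri (0, 0) (-b, 0) (0, a) (L * (a + b)) =
      {z : ℝ × ℝ | z.1 ≤ 0 ∧ 0 ≤ z.2 ∧ b * z.2 ≤ a * z.1 + L * (a + b) * a * b} := by
    ext z
    have hD : 0 < cross ((0, a) : ℝ × ℝ) (-b, 0) := by simp [cross]; positivity
    rw [tri_swap, mem_tri_iff hD]
    simp only [cross, Prod.fst_sub, Prod.snd_sub, Set.mem_ofPred_eq]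
    constructor
    · rintro ⟨h1, h2, h3⟩
      refine ⟨?_, ?_, by linarith⟩
      · nlinarith
      · nlinarith
    · rintro ⟨h1, h2, h3⟩
      refine ⟨?_, ?_, by linarith⟩
      · nlinarith
      · nlinarith
  have e2 : tri (0, L * a * b) (b, -b) (0, a) (L * a) =
      {z : ℝ × ℝ | 0 ≤ z.1 ∧ L * a * b ≤ z.1 + z.2 ∧
        (a + b) * z.1 + b * z.2 ≤ L * (a + b) * a * b} := by
    ext z
    have hD : 0 < cross ((b, -b) : ℝ × ℝ) (0, a) := by simp [cross]; positivity
    rw [mem_tri_iff hD]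
    simp only [cross, Prod.fst_sub, Prod.snd_sub, Set.mem_ofPred_eq]
    constructor
    · rintro ⟨h1, h2, h3⟩
      refine ⟨?_, ?_, by linarith⟩
      · nlinarith
      · nlinarith
    · rintro ⟨h1, h2, h3⟩
      refine ⟨?_, ?_, by linarith⟩
      · nlinarith
      · nlinarith
  rw [e1] at h1
  rw [e2] at h2
  have hLab : 0 < L * a * b := by positivity
  refine h1.glue (h3.glue h2 1 1 (L * a * b) (by simp) ?_ ?_ rfl) 1 0 0 (by simp) ?_ ?_ ?_
  · rintro z ⟨h1, h2, h3⟩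
    linarith
  · rintro z ⟨h1, h2, h3⟩
    linarith
  · rintro z ⟨h1, h2, h3⟩
    linarith
  · rintro z (⟨h1, h2, h3⟩ | ⟨h1, h2, h3⟩) <;> linarith
  · ext z
    have hD : 0 < cross ((L * b * (2 * a + b), 0) : ℝ × ℝ)
        (L * (a + b) * b, L * (a + b) * a) := by simp [cross]; positivity
    obtain ⟨X, hX⟩ : ∃ X, X = z.1 := ⟨_, rfl⟩
    obtain ⟨Y, hY⟩ : ∃ Y, Y = z.2 := ⟨_, rfl⟩
    have hLs : 0 < L * (a + b) := by positivity
    have hLt : 0 < L * b * (2 * a + b) := by positivity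
    have hLu : 0 < L * a := by positivity
    have key : z ∈ tri (-(L * (a + b) * b), 0) (L * b * (2 * a + b), 0)
        (L * (a + b) * b, L * (a + b) * a) 1 ↔ 0 ≤ Y ∧ b * Y ≤ a * X + L * (a + b) * a * b ∧
        (a + b) * X + b * Y ≤ L * (a + b) * a * b := by
      rw [mem_tri_iff hD]
      simp only [cross, Prod.fst_sub, Prod.snd_sub, ← hX, ← hY]
      rw [show (X - -(L * (a + b) * b)) * (L * (a + b) * a) - (Y - 0) * (L * (a + b) * b) =
        L * (a + b) * (a * X + L * (a + b) * a * b - b * Y) by ring,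
        mul_nonneg_iff_of_pos_left hLs,
        show L * b * (2 * a + b) * (Y - 0) - 0 * (X - -(L * (a + b) * b)) =
          L * b * (2 * a + b) * Y by ring, mul_nonneg_iff_of_pos_left hLt,
        ← sub_nonneg (b := L * (a + b) * (a * X + L * (a + b) * a * b - b * Y) + _),
        show 1 * (L * b * (2 * a + b) * (L * (a + b) * a) - 0 * (L * (a + b) * b)) -
          (L * (a + b) * (a * X + L * (a + b) * a * b - b * Y) + L * b * (2 * a + b) * Y) =
          L * a * (L * (a + b) * a * b - ((a + b) * X + b * Y)) by ring,
        mul_nonneg_iff_of_pos_left hLu]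
      constructor
      · rintro ⟨h1, h2, h3⟩
        exact ⟨h2, by linarith, by linarith⟩
      · rintro ⟨h1, h2, h3⟩
        exact ⟨by linarith, h1, by linarith⟩
    rw [key]
    simp only [Set.mem_union, Set.mem_ofPred_eq, ← hX, ← hY]
    constructor
    · rintro ⟨h1, h2, h3⟩
      rcases le_total X 0 with h4 | h4
      · exact Or.inl ⟨h4, h1, h2⟩
      · rcases le_total (X + Y) (L * a * b) with h5 | h5
        · exact Or.inr (Or.inl ⟨h4, h1, h5⟩)
        · exact Or.inr (Or.inr ⟨h4, h5, h3⟩)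
    · rintro (⟨h1, h2, h3⟩ | ⟨h1, h2, h3⟩ | ⟨h1, h2, h3⟩)
      · have h4 : (2 * a + b) * X ≤ 0 := mul_nonpos_of_nonneg_of_nonpos (by positivity) h1
        exact ⟨h2, h3, by linarith⟩
      · have h4 := mul_le_mul_of_nonneg_left h3 hb'.le
        have h5 := mul_le_mul_of_nonneg_left h3 (add_pos ha' hb').le
        have h6 := mul_nonneg ha'.le h1
        have h7 := mul_nonneg ha'.le h2
        have h8 := mul_nonneg hb'.le h1
        have h9 := mul_nonneg hLab.le ha'.le
        exact ⟨h2, by linarith, by linarith⟩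
      · have h5 := mul_le_mul_of_nonneg_left h2 (add_pos ha' hb').le
        have h6 := mul_nonneg ha'.le h1
        have h7 := mul_nonneg hb'.le h1
        exact ⟨(mul_nonneg_iff_of_pos_left ha').1 (by linarith), by linarith, h3⟩

/-! ### Transfer of dissections to triangles of the Euclidean plane. -/

namespace TriangleTiling

/-- The vertices of a triangle, as an affine basis of the plane. -/
noncomputable def affineBasis (T : Affine.Triangle ℝ Plane) : AffineBasis (Fin 3) ℝ Plane :=
  ⟨T.points, T.independent, by
    rw [T.independent.affineSpan_eq_top_iff_card_eq_finrank_add_one]; simp⟩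

theorem closedInterior_eq_coord (T : Affine.Triangle ℝ Plane) :
    T.closedInterior = {x | ∀ i, 0 ≤ (affineBasis T).coord i x} := by
  rw [← Affine.Simplex.convexHull_eq_closedInterior, ← AffineBasis.convexHull_eq_nonneg_coord]
  rfl

theorem interior_closedInterior_eq_coord (T : Affine.Triangle ℝ Plane) :
    interior T.closedInterior = {x | ∀ i, 0 < (affineBasis T).coord i x} := by
  rw [← Affine.Simplex.convexHull_eq_closedInterior, ← AffineBasis.interior_convexHull]
  rfl

theorem sum_coord_smul (T : Affine.Triangle ℝ Plane) (x : Plane) :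
    x = (affineBasis T).coord 0 x • T.points 0 + (affineBasis T).coord 1 x • T.points 1 +
      (affineBasis T).coord 2 x • T.points 2 := by
  have := (affineBasis T).linear_combination_coord_eq_self x
  rw [Fin.sum_univ_three] at this
  exact this.symm

/-- Links the barycentric interior to the topological one. The upper bound 1 on each coordinate is
automatic when all are positive with sum 1. -/
theorem interior_eq (T : Affine.Triangle ℝ Plane) : T.interior = interior T.closedInterior := by
  rw [interior_closedInterior_eq_coord]
  ext x
  have hx := (affineBasis T).affineCombination_coord_eq_self x
  have hs := (affineBasis T).sum_coord_apply_eq_one x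
  have h := Affine.Simplex.affineCombination_mem_interior_iff (s := T) hs
  rw [show Finset.univ.affineCombination ℝ T.points (fun i => (affineBasis T).coord i x) = x
    from hx] at h
  rw [h]
  refine ⟨fun h i => (h i).1, fun h i => ⟨h i, ?_⟩⟩
  simp only [Set.mem_ofPred_eq] at h
  rw [Fin.sum_univ_three] at hs
  have h0 := h 0
  have h1 := h 1
  have h2 := h 2
  fin_cases i <;> simp <;> linarith

theorem mem_closedInterior_iff (T : Affine.Triangle ℝ Plane) (x : Plane) :
    x ∈ T.closedInterior ↔ ∃ s t : ℝ, 0 ≤ s ∧ 0 ≤ t ∧ s + t ≤ 1 ∧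
      x = T.points 2 + s • (T.points 0 - T.points 2) + t • (T.points 1 - T.points 2) := by
  constructor
  · intro hx
    rw [closedInterior_eq_coord] at hx
    have hs := (affineBasis T).sum_coord_apply_eq_one x
    rw [Fin.sum_univ_three] at hs
    refine ⟨(affineBasis T).coord 0 x, (affineBasis T).coord 1 x, hx 0, hx 1,
      by linarith [hx 2], ?_⟩
    have h2 : (affineBasis T).coord 2 x =
      1 - (affineBasis T).coord 0 x - (affineBasis T).coord 1 x := by linarith
    conv_lhs => rw [sum_coord_smul T x, h2]
    module
  · rintro ⟨s, t, hs, ht, hst, rfl⟩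
    have h : ∀ i, 0 ≤ ![s, t, 1 - s - t] i := by
      intro i
      fin_cases i <;> simp <;> linarith
    rw [← Affine.Simplex.convexHull_eq_closedInterior]
    have hm : ∀ i, T.points i ∈ convexHull ℝ (Set.range T.points) :=
      fun i => subset_convexHull _ _ ⟨i, rfl⟩
    have := (convex_convexHull ℝ (Set.range T.points)).sum_mem (t := Finset.univ)
      (w := ![s, t, 1 - s - t]) (z := T.points) (fun i _ => h i)
      (by simp [Fin.sum_univ_three]) (fun i _ => hm i)
    rw [Fin.sum_univ_three] at this
    convert this using 1
    simp
    module

theorem mem_closedInterior_iff' (T : Affine.Triangle ℝ Plane) (x : Plane) :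
    x ∈ T.closedInterior ↔ ∃ s t : ℝ, 0 ≤ s ∧ 0 ≤ t ∧ s + t ≤ 1 ∧
      x = T.points 0 + s • (T.points 2 - T.points 0) + t • (T.points 1 - T.points 0) := by
  rw [mem_closedInterior_iff]
  constructor
  · rintro ⟨s, t, hs, ht, hst, rfl⟩
    exact ⟨1 - s - t, t, by linarith, ht, by linarith, by module⟩
  · rintro ⟨s, t, hs, ht, hst, rfl⟩
    exact ⟨1 - s - t, t, by linarith, ht, by linarith, by module⟩

theorem affineIndependent_of_cross_ne_zero (Φ : (ℝ × ℝ) ≃L[ℝ] Plane) (o : Plane) {p u v : ℝ × ℝ}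
    (h : cross u v ≠ 0) : AffineIndependent ℝ ![o + Φ (p + u), o + Φ (p + v), o + Φ p] := by
  rw [affineIndependent_iff_not_collinear_set, collinear_iff_of_mem (p₀ := o + Φ p) (by simp)]
  rintro ⟨w, hw⟩
  obtain ⟨r, hr⟩ := hw (o + Φ (p + u)) (by simp)
  obtain ⟨r', hr'⟩ := hw (o + Φ (p + v)) (by simp)
  have key : ∀ (x : ℝ × ℝ) (r : ℝ), o + Φ (p + x) = r • w +ᵥ (o + Φ p) → x = r • Φ.symm w := by
    intro x r hx
    apply Φ.injective
    rw [map_add, vadd_eq_add] at hx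
    rw [map_smul, ContinuousLinearEquiv.apply_symm_apply]
    have : Φ x = o + (Φ p + Φ x) - (o + Φ p) := by abel
    rw [this, hx]
    abel
  apply h
  rw [key u r hr, key v r' hr']
  simp [cross]
  ring

/-- `Φ` multiplies the lengths given by `qform` by `κ`, so each dissection triangle becomes a copy
of `R`. Listing its vertices as `p + u`, `p + v`, `p` puts the sides `a`, `b`, `c` opposite vertices
0, 1, 2. At a union, each tile's interior lies in the interior of its own region, which gives
disjointness. -/
theorem Fillable.exists_tiles {a b c κ : ℝ} (ha : 0 ≤ a) (hb : 0 ≤ b) (hc : 0 ≤ c)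
    {S : Set (ℝ × ℝ)} (hS : Fillable a b c S)
    (Φ : (ℝ × ℝ) ≃L[ℝ] Plane) (hΦ : ∀ z, ‖Φ z‖ ^ 2 = κ ^ 2 * qform z) (hκ : 0 ≤ κ) (o : Plane)
    (R : Affine.Triangle ℝ Plane) (h01 : dist (R.points 0) (R.points 1) = κ * c)
    (h02 : dist (R.points 0) (R.points 2) = κ * b)
    (h12 : dist (R.points 1) (R.points 2) = κ * a) :
    ∃ (ι : Type) (_ : Fintype ι) (tile : ι → Affine.Triangle ℝ Plane),
      (∀ i, Congruent (tile i).points R.points) ∧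
      (∀ i j, i ≠ j → Disjoint (tile i).interior (tile j).interior) ∧
      (⋃ i, (tile i).closedInterior) = (fun z => o + Φ z) '' S := by
  induction hS with
  | tile p u v hu hv huv h =>
    let t : Affine.Triangle ℝ Plane :=
      ⟨![o + Φ (p + u), o + Φ (p + v), o + Φ p], affineIndependent_of_cross_ne_zero Φ o h⟩
    have norm_eq : ∀ (w : ℝ × ℝ) (l : ℝ), 0 ≤ l → qform w = l ^ 2 → ‖Φ w‖ = κ * l := by
      intro w l hl hw
      rw [← sq_eq_sq₀ (norm_nonneg _) (by positivity), hΦ, hw]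
      ring
    have t01 : dist (t.points 0) (t.points 1) = κ * c := by
      rw [← norm_eq (u - v) c hc huv, dist_eq_norm]
      congr 1
      simp only [t, Matrix.cons_val_zero, Matrix.cons_val_one, map_add, map_sub]
      abel
    have t02 : dist (t.points 0) (t.points 2) = κ * b := by
      rw [← norm_eq u b hb hu, dist_eq_norm]
      congr 1
      simp [t]
    have t12 : dist (t.points 1) (t.points 2) = κ * a := by
      rw [← norm_eq v a ha hv, dist_eq_norm]
      congr 1
      simp [t]
    refine ⟨Unit, inferInstance, fun _ => t, fun _ => ?_, fun i j hij => (hij rfl).elim, ?_⟩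
    · rw [congruent_iff_dist_eq]
      intro i j
      fin_cases i <;> fin_cases j <;>
        simp [t01, t02, t12, h01, h02, h12, dist_comm (t.points 1) (t.points 0),
          dist_comm (t.points 2) (t.points 0), dist_comm (t.points 2) (t.points 1),
          dist_comm (R.points 1) (R.points 0), dist_comm (R.points 2) (R.points 0),
          dist_comm (R.points 2) (R.points 1)]
    · rw [Set.iUnion_const]
      ext x
      have e0 : t.points 0 - t.points 2 = Φ u := by simp [t]
      have e1 : t.points 1 - t.points 2 = Φ v := by simp [t]
      rw [mem_closedInterior_iff, e0, e1]
      have e2 : t.points 2 = o + Φ p := rfl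
      rw [e2]
      constructor
      · rintro ⟨s, r, hs, hr, hsr, rfl⟩
        refine ⟨_, ⟨s, r, hs, hr, hsr, rfl⟩, ?_⟩
        simp only [map_add, map_smul]
        abel
      · rintro ⟨_, ⟨s, r, hs, hr, hsr, rfl⟩, rfl⟩
        refine ⟨s, r, hs, hr, hsr, ?_⟩
        simp only [map_add, map_smul]
        abel
  | @union S S' hS hS' h ih ih' =>
    obtain ⟨ι, _, t, h1, h2, h3⟩ := ih
    obtain ⟨ι', _, t', h1', h2', h3'⟩ := ih'
    have hcross : ∀ i j, Disjoint (t i).interior (t' j).interior := by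
      intro i j
      let Ψ : ℝ × ℝ ≃ₜ Plane := Φ.toHomeomorph.trans (Homeomorph.addLeft o)
      have hΨ : (fun z => o + Φ z) = Ψ := rfl
      have e1 : (t i).interior ⊆ Ψ '' interior S := by
        rw [interior_eq, Ψ.image_interior, ← hΨ, ← h3]
        exact interior_mono (Set.subset_iUnion (fun i => (t i).closedInterior) i)
      have e2 : (t' j).interior ⊆ Ψ '' interior S' := by
        rw [interior_eq, Ψ.image_interior, ← hΨ, ← h3']
        exact interior_mono (Set.subset_iUnion (fun i => (t' i).closedInterior) j)
      exact ((Set.disjoint_image_iff Ψ.injective).2 h).mono e1 e2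
    refine ⟨ι ⊕ ι', inferInstance, Sum.elim t t', ?_, ?_, ?_⟩
    · rintro (i | i)
      · exact h1 i
      · exact h1' i
    · rintro (i | i) (j | j) hij
      · exact h2 i j fun h => hij (by rw [h])
      · exact hcross i j
      · exact (hcross j i).symm
      · exact h2' i j fun h => hij (by rw [h])
    · rw [Set.image_union, ← h3, ← h3', Set.iUnion_sum]
      rfl

theorem TilesInto.of_fillable {a b c κ : ℝ} (ha : 0 ≤ a) (hb : 0 ≤ b) (hc : 0 ≤ c)
    {S : Set (ℝ × ℝ)} (hS : Fillable a b c S)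
    (Φ : (ℝ × ℝ) ≃L[ℝ] Plane) (hΦ : ∀ z, ‖Φ z‖ ^ 2 = κ ^ 2 * qform z) (hκ : 0 ≤ κ) (o : Plane)
    (T R : Affine.Triangle ℝ Plane) (h01 : dist (R.points 0) (R.points 1) = κ * c)
    (h02 : dist (R.points 0) (R.points 2) = κ * b)
    (h12 : dist (R.points 1) (R.points 2) = κ * a)
    (hT : T.closedInterior = (fun z => o + Φ z) '' S) : ∃ N, TilesInto T R N := by
  obtain ⟨ι, _, tile, h1, h2, h3⟩ := Fillable.exists_tiles ha hb hc hS Φ hΦ hκ o R h01 h02 h12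
  let e := Fintype.equivFin ι
  refine ⟨Fintype.card ι, tile ∘ e.symm, fun i => h1 _, fun i j hij => h2 _ _ ?_, ?_⟩
  · exact fun h => hij (e.symm.injective h)
  · rw [hT, ← h3]
    exact e.symm.surjective.iUnion_comp fun i => (tile i).closedInterior

end TriangleTiling

/-! ### Comparison of areas. -/

namespace TriangleTiling

open MeasureTheory

theorem isCompact_closedInterior (T : Affine.Triangle ℝ Plane) : IsCompact T.closedInterior :=
  Affine.Simplex.isCompact_closedInterior T

theorem convex_closedInterior (T : Affine.Triangle ℝ Plane) : Convex ℝ T.closedInterior := by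
  rw [← Affine.Simplex.convexHull_eq_closedInterior]
  exact convex_convexHull _ _

/-- The overlap lies in the two frontiers, and the frontier of a convex set is null. -/
theorem aedisjoint_closedInterior {T T' : Affine.Triangle ℝ Plane}
    (h : Disjoint T.interior T'.interior) :
    AEDisjoint volume T.closedInterior T'.closedInterior := by
  rw [interior_eq, interior_eq] at h
  have h1 := (convex_closedInterior T).addHaar_frontier volume
  have h2 := (convex_closedInterior T').addHaar_frontier volume
  refine measure_mono_null ?_ (measure_union_null h1 h2)
  rintro x ⟨hx, hx'⟩
  by_cases h3 : x ∈ interior T.closedInterior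
  · exact Or.inr ⟨subset_closure hx', fun h4 => Set.disjoint_left.1 h h3 h4⟩
  · exact Or.inl ⟨subset_closure hx, h3⟩

theorem IsTiling.sum_volume {T R : Affine.Triangle ℝ Plane} {N : ℕ}
    {tile : Fin N → Affine.Triangle ℝ Plane} (h : IsTiling T R tile) :
    volume T.closedInterior = ∑ i, volume (tile i).closedInterior := by
  rw [← h.iUnion_eq, measure_iUnion₀, tsum_fintype]
  · exact fun i j hij => aedisjoint_closedInterior (h.disjoint_interior i j hij)
  · exact fun i => (isCompact_closedInterior _).measurableSet.nullMeasurableSet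

/-- The determinant of the edge vectors of a triangle at its first vertex. -/
noncomputable def edgeDet (T : Affine.Triangle ℝ Plane) : ℝ :=
  (T.points 2 - T.points 0) 0 * (T.points 1 - T.points 0) 1 -
    (T.points 2 - T.points 0) 1 * (T.points 1 - T.points 0) 0

theorem edgeDet_sq (T : Affine.Triangle ℝ Plane) :
    edgeDet T ^ 2 = (dist (T.points 0) (T.points 1) * dist (T.points 0) (T.points 2) *
      Real.sin (vertexAngle T 0)) ^ 2 := by
  have h1 := InnerProductGeometry.cos_angle_mul_norm_mul_norm (T.points 1 - T.points 0)
    (T.points 2 - T.points 0)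
  have h2 : vertexAngle T 0 = InnerProductGeometry.angle (T.points 1 - T.points 0)
    (T.points 2 - T.points 0) := rfl
  rw [dist_comm (T.points 0), dist_comm (T.points 0), dist_eq_norm, dist_eq_norm, mul_pow,
    Real.sin_sq, mul_sub, mul_one, ← mul_pow, mul_comm _ (Real.cos _), h2, h1, mul_pow,
    EuclideanSpace.real_norm_sq_eq, EuclideanSpace.real_norm_sq_eq, PiLp.inner_apply]
  simp [edgeDet, Fin.sum_univ_two]
  ring

theorem volume_closedInterior (T : Affine.Triangle ℝ Plane) :
    volume T.closedInterior = ENNReal.ofReal |edgeDet T| *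
      volume {x : Plane | 0 ≤ x 0 ∧ 0 ≤ x 1 ∧ x 0 + x 1 ≤ 1} := by
  let u := T.points 2 - T.points 0
  let v := T.points 1 - T.points 0
  let f : Plane →ₗ[ℝ] Plane := Matrix.toEuclideanLin !![u 0, v 0; u 1, v 1]
  have hf : ∀ x, f x = x 0 • u + x 1 • v := by
    intro x
    ext i
    fin_cases i <;> simp [f, Matrix.toEuclideanLin, Matrix.mulVec, dotProduct, Fin.sum_univ_two] <;> ring
  have hdet : LinearMap.det f = edgeDet T := by
    have : LinearMap.det f = Matrix.det !![u 0, v 0; u 1, v 1] := by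
      simp [f, Matrix.toEuclideanLin]
    rw [this, Matrix.det_fin_two_of]
    simp only [edgeDet, u, v]
    ring
  have himg : T.closedInterior = (fun x => T.points 0 + x) ''
      (f '' {x : Plane | 0 ≤ x 0 ∧ 0 ≤ x 1 ∧ x 0 + x 1 ≤ 1}) := by
    ext x
    rw [mem_closedInterior_iff']
    constructor
    · rintro ⟨s, t, hs, ht, hst, rfl⟩
      refine ⟨_, ⟨!₂[s, t], ⟨by simpa, by simpa, by simpa⟩, rfl⟩, ?_⟩
      simp [hf, u, v, add_assoc]
    · rintro ⟨_, ⟨y, ⟨h1, h2, h3⟩, rfl⟩, rfl⟩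
      exact ⟨y 0, y 1, h1, h2, h3, by simp [hf, u, v, add_assoc]⟩
  rw [himg, Set.image_add_left, measure_preimage_add, Measure.addHaar_image_linearMap, hdet]

theorem volume_closedInterior_pos (T : Affine.Triangle ℝ Plane) :
    0 < volume T.closedInterior := by
  refine Measure.measure_pos_of_nonempty_interior _ ?_
  rw [← Affine.Simplex.convexHull_eq_closedInterior]
  exact ⟨_, (affineBasis T).centroid_mem_interior_convexHull⟩

theorem angle_eq_arccos (p q r : Plane) : EuclideanGeometry.angle p q r =
    Real.arccos ((dist q p ^ 2 + dist q r ^ 2 - dist p r ^ 2) / 2 / (dist q p * dist q r)) := by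
  have h : p - r = (p - q) - (r - q) := by abel
  rw [EuclideanGeometry.angle, InnerProductGeometry.angle,
    real_inner_eq_norm_mul_self_add_norm_mul_self_sub_norm_sub_mul_self_div_two,
    dist_comm q p, dist_comm q r, dist_eq_norm, dist_eq_norm, dist_eq_norm, h]
  simp only [vsub_eq_sub, sq]

theorem vertexAngle_eq_of_congruent {T R : Affine.Triangle ℝ Plane}
    (h : Congruent T.points R.points) (i : Fin 3) : vertexAngle T i = vertexAngle R i :=
  by simp only [vertexAngle, angle_eq_arccos, h.dist_eq]

theorem abs_edgeDet_eq_of_congruent {T R : Affine.Triangle ℝ Plane}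
    (h : Congruent T.points R.points) : |edgeDet T| = |edgeDet R| := by
  rw [← sq_eq_sq_iff_abs_eq_abs, edgeDet_sq, edgeDet_sq, vertexAngle_eq_of_congruent h,
    h.dist_eq, h.dist_eq]

theorem sin_vertexAngle_pos (T : Affine.Triangle ℝ Plane) (i : Fin 3) :
    0 < Real.sin (vertexAngle T i) := by
  refine EuclideanGeometry.sin_pos_of_not_collinear ?_
  have h := affineIndependent_iff_not_collinear.1 T.independent
  suffices e : ({T.points (i + 1), T.points i, T.points (i + 2)} : Set Plane) =
      Set.range T.points by rwa [e]
  ext x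
  simp only [Set.mem_insert_iff, Set.mem_singleton_iff, Set.mem_range]
  constructor
  · rintro (rfl | rfl | rfl) <;> exact ⟨_, rfl⟩
  · rintro ⟨j, rfl⟩
    have : j = i ∨ j = i + 1 ∨ j = i + 2 := by decide +revert
    rcases this with rfl | rfl | rfl <;> simp

/-- Additivity of area, with area proportional to the product of two sides and the sine of the angle
between them; the common sine cancels. -/
theorem IsTiling.card_mul {T R : Affine.Triangle ℝ Plane} {N : ℕ}
    {tile : Fin N → Affine.Triangle ℝ Plane} (h : IsTiling T R tile)
    (hang : vertexAngle T 0 = vertexAngle R 0) :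
    N * (dist (R.points 0) (R.points 1) * dist (R.points 0) (R.points 2)) =
      dist (T.points 0) (T.points 1) * dist (T.points 0) (T.points 2) := by
  obtain ⟨K, hK⟩ : ∃ K, K = volume {x : Plane | 0 ≤ x 0 ∧ 0 ≤ x 1 ∧ x 0 + x 1 ≤ 1} := ⟨_, rfl⟩
  have hT := volume_closedInterior T
  rw [← hK] at hT
  have hpos := volume_closedInterior_pos T
  have hfin : volume T.closedInterior ≠ ⊤ := (isCompact_closedInterior T).measure_ne_top
  have hK0 : K ≠ 0 := by
    rintro h0
    rw [hT, h0, mul_zero] at hpos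
    exact hpos.ne rfl
  have hKtop : K ≠ ⊤ := by
    intro h0
    rw [hT, h0, ENNReal.mul_top] at hfin
    · exact hfin rfl
    · intro h1
      rw [hT, h1, zero_mul] at hpos
      exact hpos.ne rfl
  have hsum := h.sum_volume
  simp_rw [volume_closedInterior, fun i => abs_edgeDet_eq_of_congruent (h.congruent i),
    Finset.sum_const, Finset.card_univ, Fintype.card_fin, nsmul_eq_mul, ← hK, ← mul_assoc] at hsum
  rw [ENNReal.mul_left_inj hK0 hKtop, ← ENNReal.ofReal_natCast, ← ENNReal.ofReal_mul (by simp),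
    ENNReal.ofReal_eq_ofReal_iff (abs_nonneg _) (by positivity)] at hsum
  have h1 := edgeDet_sq T
  have h2 := edgeDet_sq R
  rw [← sq_abs, hsum, mul_pow, sq_abs, h2, ← mul_pow, hang, ← mul_assoc,
    sq_eq_sq₀ (by have := (sin_vertexAngle_pos R 0).le; positivity)
      (by have := (sin_vertexAngle_pos R 0).le; positivity),
    mul_left_inj' (sin_vertexAngle_pos R 0).ne'] at h1
  exact h1

/-! ### A side of the tiled triangle as a sum of tile sides. -/

theorem fin_three_cases (j k : Fin 3) : k = j ∨ k = j + 1 ∨ k = j + 2 := by decide +revert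

theorem sum_fin_three {M : Type*} [AddCommMonoid M] (f : Fin 3 → M) (j : Fin 3) :
    ∑ i, f i = f j + f (j + 1) + f (j + 2) := by
  rw [Fin.sum_univ_three]
  fin_cases j
  · rfl
  · change f 0 + f 1 + f 2 = f 1 + f 2 + f 0
    abel
  · change f 0 + f 1 + f 2 = f 2 + f 0 + f 1
    abel

theorem affineMap_eq_sum {V : Type*} [AddCommGroup V] [Module ℝ V] (l : Plane →ᵃ[ℝ] V)
    (t : Affine.Triangle ℝ Plane) (x : Plane) (j : Fin 3) :
    l x = (affineBasis t).coord j x • l (t.points j) +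
      (affineBasis t).coord (j + 1) x • l (t.points (j + 1)) +
      (affineBasis t).coord (j + 2) x • l (t.points (j + 2)) := by
  have hs := (affineBasis t).sum_coord_apply_eq_one x
  conv_lhs => rw [← (affineBasis t).affineCombination_coord_eq_self x]
  rw [Finset.univ.map_affineCombination _ _ hs,
    Finset.affineCombination_eq_linear_combination _ _ _ hs, sum_fin_three _ j]
  rfl

section supportingLine

variable {l : Plane →ᵃ[ℝ] ℝ} {t : Affine.Triangle ℝ Plane} {x x' y : Plane}

theorem coord_eq_zero_of_pos (hl : ∀ i, 0 ≤ l (t.points i)) (hx : x ∈ t.closedInterior)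
    (hlx : l x = 0) {j : Fin 3} (hj : 0 < l (t.points j)) : (affineBasis t).coord j x = 0 := by
  rw [closedInterior_eq_coord] at hx
  have h := affineMap_eq_sum l t x j
  rw [hlx] at h
  simp only [smul_eq_mul] at h
  have h1 := mul_nonneg (hx j) hj.le
  have h2 := mul_nonneg (hx (j + 1)) (hl (j + 1))
  have h3 := mul_nonneg (hx (j + 2)) (hl (j + 2))
  exact (mul_eq_zero.1 (by linarith)).resolve_right hj.ne'

theorem eq_vertex_of_coord_eq_zero {j k : Fin 3} (hjk : j ≠ k)
    (hj : (affineBasis t).coord j x = 0) (hk : (affineBasis t).coord k x = 0)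
    (hj' : (affineBasis t).coord j x' = 0) (hk' : (affineBasis t).coord k x' = 0) : x = x' := by
  have hx := affineMap_eq_sum (AffineMap.id ℝ Plane) t x j
  have hx' := affineMap_eq_sum (AffineMap.id ℝ Plane) t x' j
  have hs := (affineBasis t).sum_coord_apply_eq_one x
  have hs' := (affineBasis t).sum_coord_apply_eq_one x'
  rw [sum_fin_three _ j] at hs hs'
  simp only [AffineMap.id_apply, hj, hj', zero_smul, zero_add] at hx hx' hs hs'
  rcases fin_three_cases j k with rfl | rfl | rfl
  · exact (hjk rfl).elim
  · rw [hk, zero_add] at hs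
    rw [hk', zero_add] at hs'
    rw [hk, hs, zero_smul, zero_add, one_smul] at hx
    rw [hk', hs', zero_smul, zero_add, one_smul] at hx'
    rw [hx, hx']
  · rw [hk, add_zero] at hs
    rw [hk', add_zero] at hs'
    rw [hk, hs, zero_smul, add_zero, one_smul] at hx
    rw [hk', hs', zero_smul, add_zero, one_smul] at hx'
    rw [hx, hx']

/-- A triangle meeting its supporting line `l = 0` in two points has a whole side there. Two
vertices off the line would leave at most one contact point, and none would make `l` vanish
identically. -/
theorem exists_unique_pos_vertex (hl : ∀ i, 0 ≤ l (t.points i)) (hy : l y = 1)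
    (hx : x ∈ t.closedInterior) (hx' : x' ∈ t.closedInterior) (hxx' : x ≠ x')
    (hlx : l x = 0) (hlx' : l x' = 0) :
    ∃ j, 0 < l (t.points j) ∧ l (t.points (j + 1)) = 0 ∧ l (t.points (j + 2)) = 0 := by
  obtain ⟨j, hj⟩ : ∃ j, 0 < l (t.points j) := by
    by_contra! h
    have h0 : ∀ i, l (t.points i) = 0 := fun i => le_antisymm (h i) (hl i)
    have := affineMap_eq_sum l t y 0
    simp [h0, hy] at this
  have key : ∀ k, j ≠ k → l (t.points k) = 0 := by
    intro k hjk
    by_contra hk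
    have hk := lt_of_le_of_ne (hl k) (Ne.symm hk)
    exact hxx' (eq_vertex_of_coord_eq_zero hjk (coord_eq_zero_of_pos hl hx hlx hj)
      (coord_eq_zero_of_pos hl hx hlx hk) (coord_eq_zero_of_pos hl hx' hlx' hj)
      (coord_eq_zero_of_pos hl hx' hlx' hk))
  have hne : ∀ j : Fin 3, j ≠ j + 1 ∧ j ≠ j + 2 := by decide
  exact ⟨j, hj, key _ (hne j).1, key _ (hne j).2⟩

/-- The midpoint of two contact points is interior to the side on the line. The direction `y` does
not depend on `t`, so two triangles sharing `x` and `x'` have a common interior point. -/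
theorem eventually_mem_interior (hl : ∀ i, 0 ≤ l (t.points i)) (hy : l y = 1)
    (hx : x ∈ t.closedInterior) (hx' : x' ∈ t.closedInterior) (hxx' : x ≠ x')
    (hlx : l x = 0) (hlx' : l x' = 0) :
    ∀ᶠ δ in 𝓝[>] (0 : ℝ), AffineMap.lineMap (midpoint ℝ x x') y δ ∈ t.interior := by
  obtain ⟨j, hj, hj1, hj2⟩ := exists_unique_pos_vertex hl hy hx hx' hxx' hlx hlx'
  have hcx := coord_eq_zero_of_pos hl hx hlx hj
  have hcx' := coord_eq_zero_of_pos hl hx' hlx' hj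
  rw [interior_eq, interior_closedInterior_eq_coord]
  simp only [Set.mem_ofPred_eq, Filter.eventually_all]
  intro k
  have hmap : ∀ δ : ℝ, (affineBasis t).coord k (AffineMap.lineMap (midpoint ℝ x x') y δ) =
      (1 - δ) * (((affineBasis t).coord k x + (affineBasis t).coord k x') / 2) +
        δ * (affineBasis t).coord k y := by
    intro δ
    rw [AffineMap.apply_lineMap, AffineMap.map_midpoint, AffineMap.lineMap_apply_ring,
      midpoint_eq_smul_add, smul_eq_mul, invOf_eq_inv]
    ring
  simp only [hmap]
  by_cases hkj : k = j
  · subst hkj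
    rw [hcx, hcx']
    have hpos : 0 < (affineBasis t).coord k y := by
      have := affineMap_eq_sum l t y k
      rw [hj1, hj2, hy] at this
      simp only [smul_eq_mul, mul_zero, add_zero] at this
      exact pos_of_mul_pos_left (by rw [← this]; exact one_pos) hj.le
    filter_upwards [self_mem_nhdsWithin] with δ hδ
    have hδ : 0 < δ := hδ
    simp only [add_zero, zero_div, mul_zero, zero_add]
    positivity
  · rw [closedInterior_eq_coord] at hx hx'
    have hpos : 0 < ((affineBasis t).coord k x + (affineBasis t).coord k x') / 2 := by
      by_contra h
      have h1 := hx k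
      have h2 := hx' k
      exact hxx' (eq_vertex_of_coord_eq_zero hkj (by linarith) hcx (by linarith) hcx')
    have hc : Continuous fun δ : ℝ =>
      (1 - δ) * (((affineBasis t).coord k x + (affineBasis t).coord k x') / 2) +
        δ * (affineBasis t).coord k y := by fun_prop
    refine (hc.tendsto 0).mono_left nhdsWithin_le_nhds |>.eventually (lt_mem_nhds ?_)
    simpa using hpos

/-- The part of a triangle on a supporting line, in the coordinate of that line. -/
theorem exists_volume_preimage_eq {P Q : Plane} (hPQ : P ≠ Q) (hl : ∀ i, 0 ≤ l (t.points i))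
    (hy : l y = 1) (hP : l P = 0) (hQ : l Q = 0)
    (hline : ∀ i, l (t.points i) = 0 → ∃ s : ℝ, t.points i = AffineMap.lineMap P Q s) :
    ∃ f : Fin 3 → ℕ, dist P Q * (volume
      ((AffineMap.lineMap P Q : ℝ →ᵃ[ℝ] Plane) ⁻¹' t.closedInterior)).toReal =
        ∑ j, f j * dist (t.points (j + 1)) (t.points (j + 2)) := by
  obtain ⟨γ, hγ⟩ : ∃ γ : ℝ →ᵃ[ℝ] Plane, γ = AffineMap.lineMap P Q := ⟨_, rfl⟩
  simp only [← hγ] at hline ⊢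
  have hγinj : Function.Injective γ := hγ ▸ AffineMap.lineMap_injective ℝ hPQ
  have hlγ : ∀ s, l (γ s) = 0 := by
    intro s
    rw [hγ, AffineMap.apply_lineMap, hP, hQ]
    simp
  by_cases hsub : (γ ⁻¹' t.closedInterior).Subsingleton
  · exact ⟨0, by simp [hsub.measure_zero]⟩
  obtain ⟨s, hs, s', hs', hss'⟩ := Set.not_subsingleton_iff.1 hsub
  obtain ⟨j, hj, hj1, hj2⟩ := exists_unique_pos_vertex hl hy hs hs' (hγinj.ne hss') (hlγ s) (hlγ s')
  obtain ⟨r, hr⟩ := hline _ hj1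
  obtain ⟨r', hr'⟩ := hline _ hj2
  have hset : γ ⁻¹' t.closedInterior = Set.uIcc r r' := by
    refine Set.Subset.antisymm ?_ ?_
    · intro x hx
      have hc := coord_eq_zero_of_pos hl hx (hlγ x) hj
      have hx' : γ x ∈ t.closedInterior := hx
      have h1 := affineMap_eq_sum (AffineMap.id ℝ Plane) t (γ x) j
      have h2 := (affineBasis t).sum_coord_apply_eq_one (γ x)
      rw [sum_fin_three _ j] at h2
      rw [closedInterior_eq_coord] at hx'
      simp only [AffineMap.id_apply, hc, zero_smul, zero_add] at h1 h2
      rw [← segment_eq_uIcc]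
      refine ⟨_, _, hx' (j + 1), hx' (j + 2), h2, hγinj ?_⟩
      rw [Convex.combo_affine_apply h2, ← hr, ← hr', ← h1]
    · rw [← segment_eq_uIcc]
      refine ((convex_closedInterior t).affine_preimage γ).segment_subset ?_ ?_
      · rw [Set.mem_preimage, ← hr]
        exact t.point_mem_closedInterior _
      · rw [Set.mem_preimage, ← hr']
        exact t.point_mem_closedInterior _
  refine ⟨Pi.single j 1, ?_⟩
  rw [hset, Real.volume_interval, ENNReal.toReal_ofReal (abs_nonneg _), Finset.sum_eq_single j]
  · rw [hr, hr', hγ, dist_lineMap_lineMap, Real.dist_eq, abs_sub_comm]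
    simp [mul_comm]
  · intro i _ hij
    simp [hij]
  · simp

end supportingLine

/-- Each tile meets the side in at most one point or in one of its own full sides, and two tiles
never share two points of it. The traces thus partition the side up to null sets, and their lengths
add up. -/
theorem IsTiling.exists_side_eq {T R : Affine.Triangle ℝ Plane} {N : ℕ}
    {tile : Fin N → Affine.Triangle ℝ Plane} (h : IsTiling T R tile) :
    ∃ f : Fin 3 → ℕ, dist (T.points 1) (T.points 2) =
      ∑ j, f j * dist (R.points (j + 1)) (R.points (j + 2)) := by
  obtain ⟨l, hl⟩ : ∃ l, l = (affineBasis T).coord 0 := ⟨_, rfl⟩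
  obtain ⟨γ, hγ⟩ : ∃ γ : ℝ →ᵃ[ℝ] Plane, γ = AffineMap.lineMap (T.points 1) (T.points 2) := ⟨_, rfl⟩
  have h12 : T.points 1 ≠ T.points 2 := T.independent.injective.ne (by decide)
  have hl0 : l (T.points 0) = 1 := by rw [hl]; exact (affineBasis T).coord_apply_eq 0
  have hl1 : l (T.points 1) = 0 := by
    rw [hl]; exact (affineBasis T).coord_apply_ne (by decide : (0 : Fin 3) ≠ 1)
  have hl2 : l (T.points 2) = 0 := by
    rw [hl]; exact (affineBasis T).coord_apply_ne (by decide : (0 : Fin 3) ≠ 2)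
  have hγinj : Function.Injective γ := hγ ▸ AffineMap.lineMap_injective ℝ h12
  have hγc : Continuous γ := γ.continuous_of_finiteDimensional
  have hlγ : ∀ s, l (γ s) = 0 := by
    intro s
    rw [hγ, AffineMap.apply_lineMap, hl1, hl2]
    simp
  have hlT : ∀ x ∈ T.closedInterior, 0 ≤ l x := by
    intro x hx
    rw [closedInterior_eq_coord] at hx
    rw [hl]; exact hx 0
  have hsubset : ∀ i, (tile i).closedInterior ⊆ T.closedInterior := fun i =>
    h.iUnion_eq ▸ Set.subset_iUnion (fun i => (tile i).closedInterior) i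
  have hvert : ∀ i j, (tile i).points j ∈ T.closedInterior := fun i j =>
    hsubset i ((tile i).point_mem_closedInterior j)
  have hlt : ∀ i j, 0 ≤ l ((tile i).points j) := fun i j => hlT _ (hvert i j)
  have hline : ∀ x ∈ T.closedInterior, l x = 0 → ∃ s ∈ Set.Icc (0 : ℝ) 1, x = γ s := by
    intro x hx hlx
    rw [closedInterior_eq_coord] at hx
    have hs := (affineBasis T).sum_coord_apply_eq_one x
    rw [Fin.sum_univ_three, ← hl, hlx, zero_add] at hs
    refine ⟨(affineBasis T).coord 2 x, ⟨hx 2, by linarith [hx 1]⟩, ?_⟩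
    have h1 := sum_coord_smul T x
    rw [← hl, hlx, zero_smul, zero_add] at h1
    rw [hγ, AffineMap.lineMap_apply_module, ← hs, add_sub_cancel_right, ← h1]
  have hunion : (⋃ i, γ ⁻¹' (tile i).closedInterior) = Set.Icc 0 1 := by
    rw [← Set.preimage_iUnion, h.iUnion_eq]
    ext s
    constructor
    · intro hs
      obtain ⟨s', hs', heq⟩ := hline _ hs (hlγ s)
      rwa [hγinj heq]
    · intro hs
      have hc := (convex_closedInterior T).affine_preimage γ
      have h0 : (0 : ℝ) ∈ γ ⁻¹' T.closedInterior := by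
        simpa [hγ] using T.point_mem_closedInterior 1
      have h1 : (1 : ℝ) ∈ γ ⁻¹' T.closedInterior := by
        simpa [hγ] using T.point_mem_closedInterior 2
      exact hc.ordConnected.out h0 h1 hs
  have hdisj : ∀ i j, i ≠ j →
      AEDisjoint volume (γ ⁻¹' (tile i).closedInterior) (γ ⁻¹' (tile j).closedInterior) := by
    intro i j hij
    refine Set.Subsingleton.measure_zero (fun s hs s' hs' => ?_) _
    by_contra hss'
    have hne := hγinj.ne hss'
    have e1 := eventually_mem_interior (hlt i) hl0 hs.1 hs'.1 hne (hlγ s) (hlγ s')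
    have e2 := eventually_mem_interior (hlt j) hl0 hs.2 hs'.2 hne (hlγ s) (hlγ s')
    obtain ⟨δ, h1, h2⟩ := (e1.and e2).exists
    exact Set.disjoint_left.1 (h.disjoint_interior i j hij) h1 h2
  have hvol : volume (Set.Icc (0 : ℝ) 1) = ∑ i, volume (γ ⁻¹' (tile i).closedInterior) := by
    rw [← hunion, measure_iUnion₀ hdisj, tsum_fintype]
    exact fun i => ((isCompact_closedInterior _).isClosed.preimage hγc).measurableSet.nullMeasurableSet
  have hfin : ∀ i, volume (γ ⁻¹' (tile i).closedInterior) ≠ ⊤ := by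
    intro i
    refine ne_top_of_le_ne_top ?_ (measure_mono (hunion ▸ Set.subset_iUnion _ i))
    simp
  have hvol' : 1 = ∑ i, (volume (γ ⁻¹' (tile i).closedInterior)).toReal := by
    rw [← ENNReal.toReal_sum (fun i _ => hfin i), ← hvol]
    simp
  choose f hf using fun i => exists_volume_preimage_eq h12 (hlt i) hl0 hl1 hl2 fun j hj => by
    obtain ⟨s, _, hs⟩ := hline _ (hvert i j) hj
    exact ⟨s, hγ ▸ hs⟩
  refine ⟨fun j => ∑ i, f i j, ?_⟩
  calc dist (T.points 1) (T.points 2)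
      = ∑ i, dist (T.points 1) (T.points 2) * (volume (γ ⁻¹' (tile i).closedInterior)).toReal := by
        rw [← Finset.mul_sum, ← hvol', mul_one]
    _ = ∑ i, ∑ j, f i j * dist (R.points (j + 1)) (R.points (j + 2)) := by
        refine Finset.sum_congr rfl fun i _ => ?_
        rw [hγ, hf i]
        simp only [(h.congruent i).dist_eq]
    _ = _ := by
        rw [Finset.sum_comm]
        simp only [Nat.cast_sum, Finset.sum_mul]

end TriangleTiling

/-! ### Trigonometry of the tile and the conclusion. -/

namespace TriangleTiling

theorem sin_vertexAngle_mul (T : Affine.Triangle ℝ Plane) :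
    Real.sin (vertexAngle T 0) * dist (T.points 0) (T.points 2) =
        Real.sin (vertexAngle T 1) * dist (T.points 1) (T.points 2) ∧
      Real.sin (vertexAngle T 0) * dist (T.points 0) (T.points 1) =
        Real.sin (vertexAngle T 2) * dist (T.points 1) (T.points 2) := by
  have h1 := EuclideanGeometry.law_sin (T.points 1) (T.points 0) (T.points 2)
  have h2 := EuclideanGeometry.law_sin (T.points 2) (T.points 0) (T.points 1)
  rw [dist_comm (T.points 2) (T.points 1)] at h1
  rw [EuclideanGeometry.angle_comm (T.points 2) (T.points 0),
    EuclideanGeometry.angle_comm (T.points 1) (T.points 2)] at h2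
  exact ⟨h1, h2⟩

theorem vertexAngle_add (T : Affine.Triangle ℝ Plane) :
    vertexAngle T 0 + vertexAngle T 1 + vertexAngle T 2 = Real.pi := by
  have h := EuclideanGeometry.angle_add_angle_add_angle_eq_pi (p₁ := T.points 1)
    (p₂ := T.points 0) (T.points 2) (T.independent.injective.ne (by decide))
  change EuclideanGeometry.angle (T.points 1) (T.points 0) (T.points 2) +
    EuclideanGeometry.angle (T.points 2) (T.points 1) (T.points 0) +
    EuclideanGeometry.angle (T.points 0) (T.points 2) (T.points 1) = Real.pi
  linarith

theorem vertexAngle_pos (T : Affine.Triangle ℝ Plane) (i : Fin 3) : 0 < vertexAngle T i := by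
  refine lt_of_le_of_ne (EuclideanGeometry.angle_nonneg _ _ _) fun h => ?_
  have := sin_vertexAngle_pos T i
  rw [← h, Real.sin_zero] at this
  exact this.false

/-- The angles `α`, `β` of a triangle with sides `a`, `b`, `c` and third angle `2π/3`. -/
structure IsTileAngles (a b c α β : ℝ) : Prop where
  add_eq : α + β = Real.pi / 3
  sin_left : Real.sin α = √3 / 2 * (a / c)
  cos_left : Real.cos α = (2 * b + a) / (2 * c)
  sin_right : Real.sin β = √3 / 2 * (b / c)
  cos_right : Real.cos β = (2 * a + b) / (2 * c)

section sides

variable {a b c α β : ℝ}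

theorem IsTileAngles.tile_sides (h : IsTileAngles a b c α β) (ha : 0 < a)
    (hc : 0 < c) {R : Affine.Triangle ℝ Plane} (h0 : vertexAngle R 0 = α)
    (h1 : vertexAngle R 1 = β) :
    ∃ ρ : ℝ, 0 < ρ ∧ dist (R.points 1) (R.points 2) = ρ * a ∧
      dist (R.points 0) (R.points 2) = ρ * b ∧ dist (R.points 0) (R.points 1) = ρ * c := by
  obtain ⟨e1, e2⟩ := sin_vertexAngle_mul R
  have hsum := vertexAngle_add R
  have h2 : vertexAngle R 2 = Real.pi - Real.pi / 3 := by linarith [h.add_eq]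
  have hs : (0 : ℝ) < √3 := by positivity
  have hd : 0 < dist (R.points 1) (R.points 2) :=
    dist_pos.2 (R.independent.injective.ne (by decide))
  rw [h0, h1, h.sin_left, h.sin_right] at e1
  rw [h0, h2, Real.sin_pi_sub, Real.sin_pi_div_three, h.sin_left] at e2
  refine ⟨dist (R.points 1) (R.points 2) / a, by positivity, by field_simp, ?_, ?_⟩
  · field_simp at e1 ⊢
    linarith
  · field_simp at e2 ⊢
    linarith

/-- The law of sines, with third angle `α + π/3`. -/
theorem IsTileAngles.triangle_sides (h : IsTileAngles a b c α β) (ha : 0 < a)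
    (hc : 0 < c) {T : Affine.Triangle ℝ Plane} (h0 : vertexAngle T 0 = α)
    (h1 : vertexAngle T 1 = 2 * β) :
    ∃ k : ℝ, 0 < k ∧ dist (T.points 1) (T.points 2) = k * (a * c) ∧
      dist (T.points 0) (T.points 2) = k * (b * (2 * a + b)) ∧
      dist (T.points 0) (T.points 1) = k * ((a + b) * c) := by
  obtain ⟨e1, e2⟩ := sin_vertexAngle_mul T
  have hsum := vertexAngle_add T
  have h2 : vertexAngle T 2 = α + Real.pi / 3 := by linarith [h.add_eq]
  have hs : (0 : ℝ) < √3 := by positivity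
  have hd : 0 < dist (T.points 1) (T.points 2) :=
    dist_pos.2 (T.independent.injective.ne (by decide))
  rw [h0, h1, Real.sin_two_mul, h.sin_left, h.sin_right, h.cos_right] at e1
  rw [h0, h2, Real.sin_add, Real.sin_pi_div_three, Real.cos_pi_div_three, h.sin_left,
    h.cos_left] at e2
  refine ⟨dist (T.points 1) (T.points 2) / (a * c), by positivity, by field_simp, ?_, ?_⟩
  · field_simp at e1 ⊢
    linarith
  · field_simp at e2 ⊢
    linarith

end sides

theorem exists_linearEquiv {e f : Plane} {κ : ℝ} (hκ : 0 < κ) (he : ‖e‖ ^ 2 = κ ^ 2)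
    (hf : ‖f‖ ^ 2 = κ ^ 2) (hef : inner ℝ e f = κ ^ 2 / 2) :
    ∃ Φ : (ℝ × ℝ) ≃L[ℝ] Plane, (∀ z, Φ z = z.1 • e + z.2 • f) ∧
      ∀ z, ‖Φ z‖ ^ 2 = κ ^ 2 * qform z := by
  let g : ℝ × ℝ →ₗ[ℝ] Plane :=
    (LinearMap.toSpanSingleton ℝ Plane e).coprod (LinearMap.toSpanSingleton ℝ Plane f)
  have hg : ∀ z, g z = z.1 • e + z.2 • f := fun z => by simp [g]
  have hnorm : ∀ z, ‖g z‖ ^ 2 = κ ^ 2 * qform z := by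
    intro z
    rw [hg, norm_add_sq_real, norm_smul, norm_smul, mul_pow, mul_pow, he, hf, inner_smul_left,
      inner_smul_right, hef, Real.norm_eq_abs, Real.norm_eq_abs, sq_abs, sq_abs]
    simp only [qform, conj_trivial]
    ring
  have hinj : Function.Injective g := by
    rw [← LinearMap.ker_eq_bot, LinearMap.ker_eq_bot']
    intro z hz
    have h := hnorm z
    rw [hz, norm_zero, zero_pow two_ne_zero, eq_comm, mul_eq_zero] at h
    have h2 : qform z = 0 := h.resolve_left (by positivity)
    have h3 : (z.1 + z.2 / 2) ^ 2 + 3 / 4 * z.2 ^ 2 = 0 := by rw [← h2, qform]; ring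
    have h4 : z.2 = 0 := by
      have : z.2 ^ 2 = 0 := by nlinarith [sq_nonneg (z.1 + z.2 / 2), sq_nonneg z.2]
      simpa using this
    have h5 : z.1 = 0 := by
      rw [h4] at h3
      simpa using h3
    ext <;> simp [h4, h5]
  let Φ := (LinearEquiv.ofInjectiveOfFinrankEq g hinj (by simp)).toContinuousLinearEquiv
  exact ⟨Φ, fun z => hg z, fun z => hnorm z⟩

theorem exists_tilesInto {a b c : ℕ} {α β : ℝ} (ha : 0 < a) (hb : 0 < b) (hc : 0 < c)
    (habc : c ^ 2 = a ^ 2 + a * b + b ^ 2) (h : IsTileAngles a b c α β)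
    {T : Affine.Triangle ℝ Plane} (h0 : vertexAngle T 0 = α) (h1 : vertexAngle T 1 = 2 * β) :
    ∃ (R : Affine.Triangle ℝ Plane) (N : ℕ),
      vertexAngle R 0 = α ∧ vertexAngle R 1 = β ∧ TilesInto T R N := by
  have ha' : (0 : ℝ) < a := by exact_mod_cast ha
  have hb' : (0 : ℝ) < b := by exact_mod_cast hb
  have hc' : (0 : ℝ) < c := by exact_mod_cast hc
  have habc' : (c : ℝ) ^ 2 = a ^ 2 + a * b + b ^ 2 := by exact_mod_cast habc
  obtain ⟨k, hk, d12, d02, d01⟩ := h.triangle_sides ha' hc' h0 h1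
  obtain ⟨L, hL⟩ : ∃ L : ℝ, L = 3 * c ^ 3 := ⟨_, rfl⟩
  have hL0 : 0 < L := by rw [hL]; positivity
  obtain ⟨u, hu⟩ : ∃ u, u = T.points 2 - T.points 0 := ⟨_, rfl⟩
  obtain ⟨v, hv⟩ : ∃ v, v = T.points 1 - T.points 0 := ⟨_, rfl⟩
  have nu : ‖u‖ = k * (b * (2 * a + b)) := by rw [hu, ← dist_eq_norm, dist_comm, d02]
  have nv : ‖v‖ = k * ((a + b) * c) := by rw [hv, ← dist_eq_norm, dist_comm, d01]
  have nuv : ‖u - v‖ = k * (a * c) := by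
    rw [hu, hv, sub_sub_sub_cancel_right, ← dist_eq_norm, dist_comm, d12]
  have iuv : inner ℝ u v = k ^ 2 * (b * (2 * a + b) * (a + b) * (2 * b + a)) / 2 := by
    rw [real_inner_eq_norm_mul_self_add_norm_mul_self_sub_norm_sub_mul_self_div_two, nu, nv, nuv]
    linear_combination (k ^ 2 * ((a + b) ^ 2 - a ^ 2) / 2) * habc'
  obtain ⟨x, hx⟩ : ∃ x, x = (L * b * (2 * a + b))⁻¹ := ⟨_, rfl⟩
  obtain ⟨y, hy⟩ : ∃ y, y = (L * (a + b))⁻¹ := ⟨_, rfl⟩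
  -- `e` and `f` are to be the images of the lattice basis, at angle `π/3` and of length `κ`. They
  -- are solved from the edge vectors `u = Lb(2a+b)e` and `v = L(a+b)(be + af)` of the dissected
  -- triangle.
  obtain ⟨e, he⟩ : ∃ e, e = x • u := ⟨_, rfl⟩
  obtain ⟨f, hf⟩ : ∃ f, f = (a : ℝ)⁻¹ • (y • v - (b : ℝ) • e) := ⟨_, rfl⟩
  obtain ⟨κ, hκ⟩ : ∃ κ, κ = k / L := ⟨_, rfl⟩
  have hκ0 : 0 < κ := by rw [hκ]; positivity
  have ne : ‖e‖ ^ 2 = κ ^ 2 := by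
    rw [he, norm_smul, Real.norm_eq_abs, mul_pow, sq_abs, nu, hx, hκ]
    field_simp
  have nyv : ‖y • v‖ ^ 2 = κ ^ 2 * c ^ 2 := by
    rw [norm_smul, Real.norm_eq_abs, mul_pow, sq_abs, nv, hy, hκ]
    field_simp
  have iev : inner ℝ e (y • v) = κ ^ 2 * (b + a / 2) := by
    rw [he, inner_smul_left, inner_smul_right, iuv, hx, hy, hκ]
    simp only [conj_trivial]
    field_simp
  have ief : inner ℝ e f = κ ^ 2 / 2 := by
    rw [hf, inner_smul_right, inner_sub_right, iev, inner_smul_right,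
      real_inner_self_eq_norm_sq, ne]
    field_simp
    ring
  have nf : ‖f‖ ^ 2 = κ ^ 2 := by
    rw [hf, norm_smul, mul_pow, norm_sub_sq_real, nyv, norm_smul, mul_pow, ne, inner_smul_right,
      real_inner_comm, iev, habc']
    simp only [Real.norm_eq_abs, sq_abs]
    field_simp
    ring
  obtain ⟨Φ, hΦ, hΦn⟩ := exists_linearEquiv hκ0 ne nf ief
  have hue : u = (L * b * (2 * a + b)) • e := by
    rw [he, hx, smul_inv_smul₀ (by positivity)]
  have hvf : v = (L * (a + b)) • ((b : ℝ) • e + (a : ℝ) • f) := by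
    rw [hf, smul_inv_smul₀ ha'.ne', add_sub_cancel, hy, smul_inv_smul₀ (by positivity)]
  have hD : cross ((-(b : ℝ), 0) : ℝ × ℝ) (0, (a : ℝ)) ≠ 0 := by
    simp [cross]; exact ⟨hb.ne', ha.ne'⟩
  let R : Affine.Triangle ℝ Plane := ⟨_, affineIndependent_of_cross_ne_zero Φ 0 (p := 0) hD⟩
  have norm_eq : ∀ (w : ℝ × ℝ) (l : ℝ), 0 ≤ l → qform w = l ^ 2 → ‖Φ w‖ = κ * l := by
    intro w l hl hw
    rw [← sq_eq_sq₀ (norm_nonneg _) (by positivity), hΦn, hw]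
    ring
  have r01 : dist (R.points 0) (R.points 1) = κ * c := by
    rw [← norm_eq (-b, -a) c hc'.le (by simp [qform, habc']; ring), dist_eq_norm]
    congr 1
    simp only [R, Matrix.cons_val_zero, Matrix.cons_val_one, zero_add, ← map_sub]
    simp
  have r02 : dist (R.points 0) (R.points 2) = κ * b := by
    rw [← norm_eq (-b, 0) b hb'.le (by simp [qform]), dist_eq_norm]
    congr 1
    simp [R]
  have r12 : dist (R.points 1) (R.points 2) = κ * a := by
    rw [← norm_eq (0, a) a ha'.le (by simp [qform]), dist_eq_norm]
    congr 1
    simp [R]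
  -- The shift sends the model vertex `(-L(a+b)b, 0)` to vertex 0 of `T`.
  have hT : T.closedInterior = (fun z => (T.points 0 + (L * (a + b) * b) • e) + Φ z) ''
      (tri (-(L * (a + b) * b), 0) (L * b * (2 * a + b), 0)
        (L * (a + b) * b, L * (a + b) * a) 1) := by
    have key : ∀ s t : ℝ, (T.points 0 + (L * (a + b) * b) • e) +
        Φ ((-(L * (a + b) * b), 0) + s • (L * b * (2 * a + b), 0) +
          t • (L * (a + b) * b, L * (a + b) * a)) = T.points 0 + s • u + t • v := by
      intro s t
      rw [hΦ, hue, hvf]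
      simp only [Prod.fst_add, Prod.snd_add, Prod.smul_fst, Prod.smul_snd, smul_eq_mul]
      module
    ext z
    rw [mem_closedInterior_iff', ← hu, ← hv]
    constructor
    · rintro ⟨s, t, hs, ht, hst, rfl⟩
      exact ⟨_, ⟨s, t, hs, ht, hst, rfl⟩, key s t⟩
    · rintro ⟨_, ⟨s, t, hs, ht, hst, rfl⟩, rfl⟩
      exact ⟨s, t, hs, ht, hst, key s t⟩
  obtain ⟨N, hN⟩ := TilesInto.of_fillable ha'.le hb'.le hc'.le
    (fillable_bigTriangle ha hb hc habc hL) Φ hΦn hκ0.le _ T R r01 r02 r12 hT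
  have hα0 : 0 < α := h0 ▸ vertexAngle_pos T 0
  have hβ0 : 0 < 2 * β := h1 ▸ vertexAngle_pos T 1
  have hπ := Real.pi_pos
  have hadd := h.add_eq
  refine ⟨R, N, ?_, ?_, hN⟩
  · rw [← Real.arccos_cos hα0.le (by linarith), h.cos_left]
    change EuclideanGeometry.angle (R.points 1) (R.points 0) (R.points 2) = _
    rw [angle_eq_arccos, r01, r02, r12]
    congr 1
    field_simp
    linear_combination habc'
  · rw [← Real.arccos_cos (by linarith : 0 ≤ β) (by linarith), h.cos_right]
    change EuclideanGeometry.angle (R.points 2) (R.points 1) (R.points 0) = _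
    rw [angle_eq_arccos, dist_comm (R.points 1) (R.points 0), dist_comm (R.points 2) (R.points 0),
      r01, r02, r12]
    congr 1
    field_simp
    linear_combination habc'

/-- If `T` and `R` have scales `k` and `ρ`, the side `kac` is an integer combination of `ρa`, `ρb`,
`ρc`, so `q = k/ρ` is rational; the area comparison then gives `N`. -/
theorem TilesInto.card_eq {a b c : ℕ} {α β : ℝ} (ha : 0 < a) (hb : 0 < b) (hc : 0 < c)
    (h : IsTileAngles a b c α β) {T R : Affine.Triangle ℝ Plane} {N : ℕ}
    (h0 : vertexAngle T 0 = α) (h1 : vertexAngle T 1 = 2 * β)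
    (h0' : vertexAngle R 0 = α) (h1' : vertexAngle R 1 = β) (hN : TilesInto T R N) :
    ∃ q : ℚ, 0 < q ∧ (N : ℝ) = q ^ 2 * ((a + b) * (2 * a + b)) := by
  have ha' : (0 : ℝ) < a := by exact_mod_cast ha
  have hb' : (0 : ℝ) < b := by exact_mod_cast hb
  have hc' : (0 : ℝ) < c := by exact_mod_cast hc
  obtain ⟨k, hk, d12, d02, d01⟩ := h.triangle_sides ha' hc' h0 h1
  obtain ⟨ρ, hρ, r12, r02, r01⟩ := h.tile_sides ha' hc' h0' h1'
  obtain ⟨tile, ht⟩ := hN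
  have hcard := ht.card_mul (h0.trans h0'.symm)
  obtain ⟨f, hf⟩ := ht.exists_side_eq
  rw [Fin.sum_univ_three] at hf
  change _ = f 0 * dist (R.points 1) (R.points 2) + f 1 * dist (R.points 2) (R.points 0) +
    f 2 * dist (R.points 0) (R.points 1) at hf
  rw [d12, r12, dist_comm (R.points 2), r02, r01] at hf
  rw [d01, d02, r01, r02] at hcard
  obtain ⟨q, hq⟩ : ∃ q : ℚ, q = (f 0 * a + f 1 * b + f 2 * c) / (a * c) := ⟨_, rfl⟩
  have hqk : (q : ℝ) = k / ρ := by
    rw [hq]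
    push_cast
    field_simp
    linarith
  refine ⟨q, ?_, ?_⟩
  · have : (0 : ℝ) < q := by rw [hqk]; positivity
    exact_mod_cast this
  · rw [hqk]
    field_simp
    have hbc : (0 : ℝ) < b * c := by positivity
    refine mul_right_cancel₀ hbc.ne' ?_
    linear_combination hcard

/-- Half-angle parametrization of the angles of the tile. -/
theorem isTileAngles_of_tan {α β t : ℝ} (hα : 0 < α) (hβ : 0 < β) (h : α + β = Real.pi / 3)
    (ht : t = Real.tan (α / 2) / √3) :
    0 < t ∧ t < 1 / 3 ∧ IsTileAngles (4 * t) ((1 - 3 * t) * (1 + t)) (1 + 3 * t ^ 2) α β := by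
  have hπ := Real.pi_pos
  have hs : (0 : ℝ) < √3 := by positivity
  have hs2 : √3 ^ 2 = 3 := Real.sq_sqrt (by norm_num)
  have htan0 : 0 < Real.tan (α / 2) := Real.tan_pos_of_pos_of_lt_pi_div_two (by linarith) (by linarith)
  have htan1 : Real.tan (α / 2) < 1 / √3 := by
    rw [← Real.tan_pi_div_six]
    exact Real.tan_lt_tan_of_nonneg_of_lt_pi_div_two (by linarith) (by linarith) (by linarith)
  have hcos : 0 < Real.cos (α / 2) := Real.cos_pos_of_mem_Ioo ⟨by linarith, by linarith⟩
  have ht0 : 0 < t := by rw [ht]; positivity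
  have ht1 : t < 1 / 3 := by
    rw [ht, div_lt_iff₀ hs]
    refine htan1.trans_le (le_of_eq ?_)
    field_simp
    linarith
  have hsin : Real.sin (α / 2) = √3 * t * Real.cos (α / 2) := by
    rw [ht, Real.tan_eq_sin_div_cos]
    field_simp
  have hcos2 : Real.cos (α / 2) ^ 2 = 1 / (1 + 3 * t ^ 2) := by
    have h1 := Real.sin_sq_add_cos_sq (α / 2)
    rw [hsin] at h1
    rw [eq_div_iff (by positivity)]
    linear_combination h1 - t ^ 2 * Real.cos (α / 2) ^ 2 * hs2
  have hα2 : α = 2 * (α / 2) := by ring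
  have hsα : Real.sin α = √3 / 2 * (4 * t / (1 + 3 * t ^ 2)) := by
    rw [hα2, Real.sin_two_mul, hsin]
    linear_combination (2 * √3 * t) * hcos2
  have hcα : Real.cos α = (1 - 3 * t ^ 2) / (1 + 3 * t ^ 2) := by
    rw [hα2, Real.cos_two_mul, hcos2]
    field_simp
    ring
  have hβ' : β = Real.pi / 3 - α := by linarith
  refine ⟨ht0, ht1, h, hsα, ?_, ?_, ?_⟩
  · rw [hcα]
    field_simp
    ring
  · rw [hβ', Real.sin_sub, Real.sin_pi_div_three, Real.cos_pi_div_three, hsα, hcα]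
    field_simp
    ring
  · rw [hβ', Real.cos_sub, Real.sin_pi_div_three, Real.cos_pi_div_three, hsα, hcα]
    field_simp
    rw [hs2]
    ring

theorem IsTileAngles.scale {a b c α β r : ℝ} (h : IsTileAngles a b c α β) (hr : r ≠ 0) :
    IsTileAngles (r * a) (r * b) (r * c) α β where
  add_eq := h.add_eq
  sin_left := by rw [h.sin_left, mul_div_mul_left _ _ hr]
  cos_left := by
    rw [h.cos_left, ← mul_div_mul_left _ _ hr]
    congr 1 <;> ring
  sin_right := by rw [h.sin_right, mul_div_mul_left _ _ hr]
  cos_right := by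
    rw [h.cos_right, ← mul_div_mul_left _ _ hr]
    congr 1 <;> ring

end TriangleTiling

theorem mainTheorem7 (T : Affine.Triangle ℝ Plane) (A B C t : ℝ)
    (hA : TriangleTiling.vertexAngle T 0 = A)
    (hB : TriangleTiling.vertexAngle T 1 = B)
    (hC : TriangleTiling.vertexAngle T 2 = C)
    (hinc : ¬ TriangleTiling.HasCommensurableAngles T)
    (hCAB : C = 2 * A + B / 2)
    (hrat : ∃ q : ℚ, Real.sqrt 3 * Real.tan (A / 2) = (q : ℝ))
    (ht : t = Real.tan (A / 2) / Real.sqrt 3) :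
    (∃ (R : Affine.Triangle ℝ Plane) (N : ℕ),
      TriangleTiling.vertexAngle R 0 = A ∧ TriangleTiling.vertexAngle R 1 = B / 2 ∧
        TriangleTiling.TilesInto T R N) ∧
    ∀ (R : Affine.Triangle ℝ Plane) (N : ℕ),
      TriangleTiling.vertexAngle R 0 = A → TriangleTiling.vertexAngle R 1 = B / 2 →
        TriangleTiling.TilesInto T R N →
          (∃ q : ℚ, (N : ℝ) = (3 * t ^ 2 - 6 * t - 1) / ((t - 1) * (3 * t + 1)) * (q : ℝ) ^ 2) ∧
          ¬ IsSquare N := by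
  have hA0 : 0 < A := hA ▸ TriangleTiling.vertexAngle_pos T 0
  have hB0 : 0 < B := hB ▸ TriangleTiling.vertexAngle_pos T 1
  have hsum := TriangleTiling.vertexAngle_add T
  rw [hA, hB, hC] at hsum
  -- The angle sum with `C = 2A + B/2` reads `A + B/2 = π/3`.
  obtain ⟨ht0, ht1, hang⟩ := TriangleTiling.isTileAngles_of_tan (β := B / 2) hA0 (by linarith)
    (by linarith) ht
  obtain ⟨p, hp⟩ : ∃ p : ℚ, t = p := by
    obtain ⟨q, hq⟩ := hrat
    refine ⟨q / 3, ?_⟩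
    have hs2 : √3 ^ 2 = 3 := Real.sq_sqrt (by norm_num)
    rw [ht]
    push_cast
    rw [← hq]
    field_simp
    rw [hs2, mul_comm]
  have hp0 : 0 < p := by rw [hp] at ht0; exact_mod_cast ht0
  have hp1 : p < 1 / 3 := by
    rw [hp] at ht1
    have : (p : ℝ) < ((1 / 3 : ℚ) : ℝ) := by push_cast; exact ht1
    exact_mod_cast this
  obtain ⟨m, hm⟩ : ∃ m : ℕ, p.num = m := ⟨p.num.toNat, by
    have := Rat.num_pos.2 hp0; omega⟩
  obtain ⟨n, hn⟩ : ∃ n : ℕ, p.den = n := ⟨_, rfl⟩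
  have hn0 : 0 < n := hn ▸ p.den_pos
  have hn0' : (0 : ℝ) < n := by exact_mod_cast hn0
  have htmn : t * n = m := by
    rw [hp, ← hn]
    have h1 := Rat.mul_den_eq_num p
    rw [hm] at h1
    exact_mod_cast h1
  have hm0 : 0 < m := by
    have : (0 : ℝ) < m := htmn ▸ mul_pos ht0 hn0'
    exact_mod_cast this
  have hmn : 3 * m < n := by
    have : (3 * m : ℝ) < n := by rw [← htmn]; nlinarith
    exact_mod_cast this
  obtain ⟨d, hd⟩ : ∃ d, n = 3 * m + d := ⟨n - 3 * m, by omega⟩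
  have hd0 : 0 < d := by omega
  -- The sides in terms of `t = m/n`, cleared of denominators by `n²`; `d` stands for `n - 3m`.
  obtain ⟨a, ha⟩ : ∃ a, a = 4 * m * n := ⟨_, rfl⟩
  obtain ⟨b, hb⟩ : ∃ b, b = d * (n + m) := ⟨_, rfl⟩
  obtain ⟨c, hc⟩ : ∃ c, c = n ^ 2 + 3 * m ^ 2 := ⟨_, rfl⟩
  have ha0 : 0 < a := by rw [ha]; positivity
  have hb0 : 0 < b := by rw [hb]; positivity
  have hc0 : 0 < c := by rw [hc]; positivity
  have habc : c ^ 2 = a ^ 2 + a * b + b ^ 2 := by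
    rw [ha, hb, hc, hd]; ring
  have hdr : (d : ℝ) = n - 3 * m := by rw [hd]; push_cast; ring
  have har : (a : ℝ) = n ^ 2 * (4 * t) := by rw [ha]; push_cast; rw [← htmn]; ring
  have hbr : (b : ℝ) = n ^ 2 * ((1 - 3 * t) * (1 + t)) := by
    rw [hb]; push_cast; rw [hdr, ← htmn]; ring
  have hcr : (c : ℝ) = n ^ 2 * (1 + 3 * t ^ 2) := by rw [hc]; push_cast; rw [← htmn]; ring
  have hang' : TriangleTiling.IsTileAngles a b c A (B / 2) := by
    rw [har, hbr, hcr]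
    exact hang.scale (by positivity)
  have hB2 : TriangleTiling.vertexAngle T 1 = 2 * (B / 2) := by rw [hB]; ring
  refine ⟨TriangleTiling.exists_tilesInto ha0 hb0 hc0 habc hang' hA hB2, fun R N hR0 hR1 hN => ?_⟩
  obtain ⟨q, hq0, hq⟩ := hN.card_eq ha0 hb0 hc0 hang' hA hB2 hR0 hR1
  -- `(a+b)(2a+b) = (a+b)² · (2a+b)/(a+b)`. Up to the common factor `n²`, `a+b` is `(1-t)(1+3t)` and
  -- `2a+b` is `1+6t-3t²`.
  have hformula : (N : ℝ) = (3 * t ^ 2 - 6 * t - 1) / ((t - 1) * (3 * t + 1)) *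
      ((q * (a + b) : ℚ) : ℝ) ^ 2 := by
    have h1 : t - 1 ≠ 0 := by linarith
    have h2 : 3 * t + 1 ≠ 0 := by linarith
    push_cast
    rw [hq, har, hbr]
    field_simp
    ring
  refine ⟨⟨_, hformula⟩, ?_⟩
  rintro ⟨r, hr⟩
  refine not_isSquare_quartic hp0 hp1 ⟨r / (q * (a + b)), ?_⟩
  have hab : (0 : ℚ) < q * (a + b) := by
    have : (0 : ℚ) < a := by exact_mod_cast ha0
    positivity
  have h3 : (N : ℚ) = (3 * p ^ 2 - 6 * p - 1) / ((p - 1) * (3 * p + 1)) * (q * (a + b)) ^ 2 := by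
    rw [hp] at hformula
    exact_mod_cast hformula
  rw [hr] at h3
  push_cast at h3
  rw [div_mul_div_comm, eq_div_iff (by positivity), h3]
  ring
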